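/- Fix $\sigma>0$. There is a constant $C>0$, depending only on $\sigma$, such that the following holds. Let $\Omega\subset\mathbb R^2$ be a bounded open set with a uniform rectangular triangulation $\mathcal T_h$: $\mathcal T_h$ is a finite set of closed axis-parallel rectangles, all translates of one another and taken from the cells of one rectangular lattice, with half side lengths $h_1,h_2>0$ satisfying $h_1\le\sigma h_2$ and $h_2\le\sigma h_1$, and $\Omega$ is the interior of $\bigcup_{K\in\mathcal T_h}K$. Put $h=\max(h_1,h_2)$ (for a mesh of squares, $2h$ is the side length). Let $V_h$ be the rectangular Morley element space, i.e. the space of all $v\in L^2(\Omega)$ such that $v|_K\in P_2(K)+\mathrm{span}\{x_1^3,x_2^3\}$ for all $K\in\mathcal T_h$, $v$ is continuous at all internal vertices and vanishes at all boundary vertices of $\mathcal T_h$, and $\int_e\frac{\partial v}{\partial n_e}\,ds$ is continuous across all internal edges $e$ and vanishes on all boundary edges $e$. Let $a_h(v,w)=\sum_{K\in\mathcal T_h}\int_K\nabla^2v:\nabla^2w\,dx$ and $|w|_h=a_h(w,w)^{1/2}$, where $\nabla^2$ is the Hessian, taken element by element. Let $f\in L^2(\Omega)$ and let $u\in H^2_0(\Omega)\cap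 H^4(\Omega)$ be the weak solution of $\Delta^2u=f$ in $\Omega$, $u=\frac{\partial u}{\partial n}=0$ on $\partial\Omega$, i.e. $\int_\Omega\nabla^2u:\nabla^2v\,dx=\int_\Omega fv\,dx$ for all $v\in H^2_0(\Omega)$. Then the consistency error satisfies $$a_h(u,w_h)-(f,w_h)_{L^2(\Omega)}\le C\,h^2\bigl(\|f\|_{L^2(\Omega)}+|u|_{H^4(\Omega)}\bigr)\,|w_h|_h\qquad\text{for all } w_h\in V_h .$$ -/

import Mathlib

open MeasureTheory Filter Topology
open scoped ContDiff

noncomputable section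

namespace RectMorley

/-! ### Weak derivatives and Sobolev spaces on an open subset of the plane

Multi-indices are pairs `α : ℕ × ℕ`, of order `α.1 + α.2`. -/

/-- The classical partial derivative in the first variable. -/
def pdx (v : ℝ × ℝ → ℝ) (z : ℝ × ℝ) : ℝ := fderiv ℝ v z (1, 0)

/-- The classical partial derivative in the second variable. -/
def pdy (v : ℝ × ℝ → ℝ) (z : ℝ × ℝ) : ℝ := fderiv ℝ v z (0, 1)

/-- The classical partial derivative of multi-index `α`. -/
def partialDeriv (α : ℕ × ℕ) (v : ℝ × ℝ → ℝ) : ℝ × ℝ → ℝ := pdx^[α.1] (pdy^[α.2] v)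

/-- Test functions: `φ ∈ C_c^∞(Ω)`. -/
def IsTestFunction (Ω : Set (ℝ × ℝ)) (φ : ℝ × ℝ → ℝ) : Prop :=
  ContDiff ℝ ∞ φ ∧ HasCompactSupport φ ∧ tsupport φ ⊆ Ω

/-- `g` is a weak derivative of `u` on `Ω` of multi-index `α`. -/
def IsWeakDeriv (Ω : Set (ℝ × ℝ)) (α : ℕ × ℕ) (u g : ℝ × ℝ → ℝ) : Prop :=
  LocallyIntegrableOn u Ω ∧ LocallyIntegrableOn g Ω ∧
    ∀ φ : ℝ × ℝ → ℝ, IsTestFunction Ω φ →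
      ∫ z in Ω, u z * partialDeriv α φ z = (-1) ^ (α.1 + α.2) * ∫ z in Ω, g z * φ z

open Classical in
/-- The weak derivative of multi-index `α` on the open set `Ω`, unique almost everywhere in `Ω`
where it exists (and `0` by convention if there is none). -/
def weakDeriv (Ω : Set (ℝ × ℝ)) (α : ℕ × ℕ) (u : ℝ × ℝ → ℝ) : ℝ × ℝ → ℝ :=
  if h : ∃ g, IsWeakDeriv Ω α u g then h.choose else 0

/-- `v ∈ L²(Ω)`. -/
def MemL2 (Ω : Set (ℝ × ℝ)) (v : ℝ × ℝ → ℝ) : Prop := MemLp v 2 (volume.restrict Ω)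

/-- The norm of `L²(Ω)`. -/
def normL2 (Ω : Set (ℝ × ℝ)) (v : ℝ × ℝ → ℝ) : ℝ := √(∫ z in Ω, v z ^ 2)

/-- The Sobolev space `H^m(Ω)`. -/
def MemH (Ω : Set (ℝ × ℝ)) (m : ℕ) (u : ℝ × ℝ → ℝ) : Prop :=
  MemL2 Ω u ∧ ∀ α : ℕ × ℕ, α.1 + α.2 ≤ m → ∃ g, MemL2 Ω g ∧ IsWeakDeriv Ω α u g

/-- The seminorm `|u|_{H^m(Ω)}`, built from the weak derivatives of order exactly `m`. -/
def seminormH (Ω : Set (ℝ × ℝ)) (m : ℕ) (u : ℝ × ℝ → ℝ) : ℝ :=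
  √(∑ α ∈ Finset.HasAntidiagonal.antidiagonal m, ∫ z in Ω, weakDeriv Ω α u z ^ 2)

/-- `H²₀(Ω)`: the closure of `C_c^∞(Ω)` in `H²(Ω)`. -/
def MemH20 (Ω : Set (ℝ × ℝ)) (u : ℝ × ℝ → ℝ) : Prop :=
  MemH Ω 2 u ∧ ∃ φ : ℕ → ℝ × ℝ → ℝ, (∀ n, IsTestFunction Ω (φ n)) ∧
    ∀ α : ℕ × ℕ, α.1 + α.2 ≤ 2 →
      Tendsto (fun n => normL2 Ω (fun z => partialDeriv α (φ n) z - weakDeriv Ω α u z))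
        atTop (𝓝 0)

/-- `∫_Ω ∇²u : ∇²v`, the `L²(Ω)` inner product of the Hessian matrices. -/
def hessForm (Ω : Set (ℝ × ℝ)) (u v : ℝ × ℝ → ℝ) : ℝ :=
  ∫ z in Ω, (weakDeriv Ω (2, 0) u z * weakDeriv Ω (2, 0) v z
    + 2 * (weakDeriv Ω (1, 1) u z * weakDeriv Ω (1, 1) v z)
    + weakDeriv Ω (0, 2) u z * weakDeriv Ω (0, 2) v z)

/-- `u ∈ H²₀(Ω)` is the variational solution of the clamped plate problem `Δ²u = f` in `Ω`,
`u = ∂u/∂n = 0` on `∂Ω`. -/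
def IsBiharmonicSolution (Ω : Set (ℝ × ℝ)) (f u : ℝ × ℝ → ℝ) : Prop :=
  MemH20 Ω u ∧ ∀ v, MemH20 Ω v → hessForm Ω u v = ∫ z in Ω, f z * v z

/-! ### Uniform rectangular meshes -/

/-- A uniform rectangular mesh: finitely many translates of one rectangle of half side lengths
`h₁`, `h₂`, taken from the cells of a lattice. -/
structure UniformMesh where
  /-- a vertex of the lattice -/
  origin : ℝ × ℝ
  h₁ : ℝ
  h₂ : ℝ
  h₁_pos : 0 < h₁
  h₂_pos : 0 < h₂
  /-- the cells of the lattice (named by their lower left corners) that belong to the mesh -/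
  cells : Finset (ℤ × ℤ)

namespace UniformMesh

variable (M : UniformMesh)

/-- The meshsize (for a mesh of squares, the side length is `2h`). -/
def h : ℝ := max M.h₁ M.h₂

/-- The lattice points. -/
def vertex (m : ℤ × ℤ) : ℝ × ℝ :=
  (M.origin.1 + 2 * M.h₁ * m.1, M.origin.2 + 2 * M.h₂ * m.2)

/-- The closed rectangle `K` with lower left corner `vertex k`. -/
def cell (k : ℤ × ℤ) : Set (ℝ × ℝ) := Set.Icc (M.vertex k) (M.vertex (k + (1, 1)))

/-- The horizontal edge with left end point `vertex m`. -/
def hEdge (m : ℤ × ℤ) : Set (ℝ × ℝ) := Set.Icc (M.vertex m) (M.vertex (m + (1, 0)))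

/-- The vertical edge with lower end point `vertex m`. -/
def vEdge (m : ℤ × ℤ) : Set (ℝ × ℝ) := Set.Icc (M.vertex m) (M.vertex (m + (0, 1)))

/-- `∫_e ∂v/∂n_e ds` over the horizontal edge `e = hEdge m`, where `n_e = (0, 1)`. -/
def hFlux (m : ℤ × ℤ) (v : ℝ × ℝ → ℝ) : ℝ :=
  ∫ s in (M.vertex m).1..(M.vertex (m + (1, 0))).1, pdy v (s, (M.vertex m).2)

/-- `∫_e ∂v/∂n_e ds` over the vertical edge `e = vEdge m`, where `n_e = (1, 0)`. -/
def vFlux (m : ℤ × ℤ) (v : ℝ × ℝ → ℝ) : ℝ :=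
  ∫ s in (M.vertex m).2..(M.vertex (m + (0, 1))).2, pdx v ((M.vertex m).1, s)

/-- The mesh is a triangulation of the open set `Ω`. -/
def Triangulates (Ω : Set (ℝ × ℝ)) : Prop := Ω = interior (⋃ k ∈ M.cells, M.cell k)

end UniformMesh

/-! ### The rectangular Morley element -/

/-- `P_l`: polynomials of total degree at most `l`. -/
def polySpace (l : ℕ) : Submodule ℝ (ℝ × ℝ → ℝ) :=
  Submodule.span ℝ {q | ∃ a b : ℕ, a + b ≤ l ∧ q = fun z => z.1 ^ a * z.2 ^ b}

/-- The shape function space `P_2 + span {x₁³, x₂³}`. -/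
def shapeSpace : Submodule ℝ (ℝ × ℝ → ℝ) :=
  polySpace 2 ⊔ Submodule.span ℝ {fun z => z.1 ^ 3, fun z => z.2 ^ 3}

namespace UniformMesh

variable (M : UniformMesh)

/-- The conditions that the pieces `p k = v|_K` of a Morley function satisfy. -/
structure IsMorleyFamily (Ω : Set (ℝ × ℝ)) (p : ℤ × ℤ → ℝ × ℝ → ℝ) : Prop where
  shape : ∀ k ∈ M.cells, p k ∈ shapeSpace
  /-- continuity at internal vertices -/
  vertex_internal : ∀ m, ∀ k ∈ M.cells, ∀ k' ∈ M.cells, M.vertex m ∈ Ω →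
    M.vertex m ∈ M.cell k → M.vertex m ∈ M.cell k' → p k (M.vertex m) = p k' (M.vertex m)
  vertex_boundary : ∀ m, ∀ k ∈ M.cells, M.vertex m ∈ frontier Ω →
    M.vertex m ∈ M.cell k → p k (M.vertex m) = 0
  /-- continuity of `∫_e ∂v/∂n_e ds` on internal edges, i.e. edges shared by two cells -/
  hEdge_internal : ∀ m, ∀ k ∈ M.cells, ∀ k' ∈ M.cells,
    M.hEdge m ⊆ M.cell k → M.hEdge m ⊆ M.cell k' → M.hFlux m (p k) = M.hFlux m (p k')
  hEdge_boundary : ∀ m, ∀ k ∈ M.cells, M.hEdge m ⊆ frontier Ω →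
    M.hEdge m ⊆ M.cell k → M.hFlux m (p k) = 0
  vEdge_internal : ∀ m, ∀ k ∈ M.cells, ∀ k' ∈ M.cells,
    M.vEdge m ⊆ M.cell k → M.vEdge m ⊆ M.cell k' → M.vFlux m (p k) = M.vFlux m (p k')
  vEdge_boundary : ∀ m, ∀ k ∈ M.cells, M.vEdge m ⊆ frontier Ω →
    M.vEdge m ⊆ M.cell k → M.vFlux m (p k) = 0

/-- The rectangular Morley element space `V_h ⊆ L²(Ω)`. -/
def MemMorley (Ω : Set (ℝ × ℝ)) (v : ℝ × ℝ → ℝ) : Prop :=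
  MemL2 Ω v ∧ ∃ p : ℤ × ℤ → ℝ × ℝ → ℝ, M.IsMorleyFamily Ω p ∧
    ∀ k ∈ M.cells, v =ᵐ[volume.restrict (M.cell k)] p k

/-- The discrete bilinear form `a_h(u, v) = (∇_h² u, ∇_h² v)`, the Hessians being taken
element by element (in the interior of each cell). -/
def discreteForm (u v : ℝ × ℝ → ℝ) : ℝ := ∑ k ∈ M.cells, hessForm (interior (M.cell k)) u v

/-- The discrete energy seminorm `|v|_h`. -/
def discreteSeminorm (v : ℝ × ℝ → ℝ) : ℝ := √(M.discreteForm v v)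

end UniformMesh

end RectMorley

end

open RectMorley

noncomputable section

namespace RectMorley

/-! ### Integration by parts for weak derivatives on intervals and rectangles -/

theorem setIntegral_Ioo_eq_intervalIntegral {a c : ℝ} (hac : a ≤ c) (g : ℝ → ℝ) :
    ∫ x in Set.Ioo a c, g x = ∫ x in a..c, g x := by
  rw [intervalIntegral.integral_of_le hac, integral_Ioc_eq_integral_Ioo]

/-- A smooth function with compact support in `(a, c)` and mean zero is the derivative of a smooth
function with compact support in `(a, c)`. -/
theorem exists_primitive_of_integral_eq_zero {a c : ℝ} (hac : a < c) {θ : ℝ → ℝ}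
    (hθ : ContDiff ℝ ∞ θ) (hs : HasCompactSupport θ) (hsub : tsupport θ ⊆ Set.Ioo a c)
    (h0 : ∫ x in a..c, θ x = 0) :
    ∃ ζ : ℝ → ℝ, ContDiff ℝ ∞ ζ ∧ HasCompactSupport ζ ∧ tsupport ζ ⊆ Set.Ioo a c ∧
      deriv ζ = θ := by
  obtain ⟨a', c', ha', hc', hK⟩ : ∃ a' c', a < a' ∧ c' < c ∧ tsupport θ ⊆ Set.Icc a' c' := by
    rcases (tsupport θ).eq_empty_or_nonempty with he | hne
    · exact ⟨(a + c) / 2, (a + c) / 2, by linarith, by linarith, by simp [he]⟩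
    · obtain ⟨m, hm⟩ := hs.isCompact.exists_isLeast hne
      obtain ⟨n, hn⟩ := hs.isCompact.exists_isGreatest hne
      exact ⟨m, n, (hsub hm.1).1, (hsub hn.1).2, fun x hx => ⟨hm.2 hx, hn.2 hx⟩⟩
  have hz : ∀ x, x ∉ Set.Icc a' c' → θ x = 0 := fun x hx =>
    image_eq_zero_of_notMem_tsupport fun h => hx (hK h)
  have hd : ∀ x, HasDerivAt (fun x => ∫ t in a..x, θ t) (θ x) x := fun x =>
    intervalIntegral.integral_hasDerivAt_right (hθ.continuous.intervalIntegrable _ _)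
      (hθ.continuous.stronglyMeasurableAtFilter _ _) hθ.continuous.continuousAt
  have hder : deriv (fun x => ∫ t in a..x, θ t) = θ := funext fun x => (hd x).deriv
  have hsupp : tsupport (fun x => ∫ t in a..x, θ t) ⊆ Set.Icc a' c' := by
    refine closure_minimal ?_ isClosed_Icc
    intro x hx
    by_contra hx'
    apply hx
    rcases lt_or_ge x a' with h | h
    · refine intervalIntegral.integral_zero_ae (Eventually.of_forall fun t ht => hz t fun h' => ?_)
      rcases Set.mem_uIoc.1 ht with h1 | h1 <;> linarith [h1.1, h1.2, h'.1]
    · have hx2 : c' < x := by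
        by_contra h2
        exact hx' ⟨h, not_lt.1 h2⟩
      have h3 : ∫ t in x..c, θ t = 0 :=
        intervalIntegral.integral_zero_ae (Eventually.of_forall fun t ht => hz t fun h' => by
          rcases Set.mem_uIoc.1 ht with h1 | h1 <;> linarith [h1.1, h1.2, h'.2])
      have h4 := intervalIntegral.integral_add_adjacent_intervals
        (hθ.continuous.intervalIntegrable (μ := volume) a x)
        (hθ.continuous.intervalIntegrable (μ := volume) x c)
      change ∫ t in a..x, θ t = 0
      linarith
  refine ⟨fun x => ∫ t in a..x, θ t, ?_, isCompact_Icc.of_isClosed_subset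
    (isClosed_tsupport _) hsupp, fun x hx => ⟨ha'.trans_le (hsupp hx).1,
      (hsupp hx).2.trans_lt hc'⟩, hder⟩
  rw [contDiff_infty_iff_deriv]
  exact ⟨fun x => (hd x).differentiableAt, by rw [hder]; exact hθ⟩

/-- The lemma of du Bois-Reymond: an integrable function on an interval that is orthogonal to the
derivatives of all test functions is constant. -/
theorem ae_eq_const_of_integral_mul_deriv_eq_zero {H : ℝ → ℝ} {a c : ℝ} (hac : a < c)
    (hH : IntegrableOn H (Set.Ioo a c))
    (h : ∀ η : ℝ → ℝ, ContDiff ℝ ∞ η → HasCompactSupport η → tsupport η ⊆ Set.Ioo a c →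
      ∫ x in Set.Ioo a c, H x * deriv η x = 0) :
    ∃ C : ℝ, ∀ᵐ x, x ∈ Set.Ioo a c → H x = C := by
  let b : ContDiffBump ((a + c) / 2) :=
    ⟨(c - a) / 8, (c - a) / 4, by linarith, by linarith⟩
  let ρ : ℝ → ℝ := b.normed volume
  have hρ : ContDiff ℝ ∞ ρ := b.contDiff_normed
  have hρs : HasCompactSupport ρ := b.hasCompactSupport_normed
  have hρsub : tsupport ρ ⊆ Set.Ioo a c := by
    intro x hx
    rw [show tsupport ρ = _ from b.tsupport_normed_eq, Metric.mem_closedBall, Real.dist_eq,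
      abs_le] at hx
    have h1 : b.rOut = (c - a) / 4 := rfl
    constructor <;> linarith [hx.1, hx.2]
  have toIoo : ∀ g : ℝ → ℝ, tsupport g ⊆ Set.Ioo a c → ∫ x in Set.Ioo a c, g x = ∫ x, g x :=
    fun g hg => setIntegral_eq_integral_of_forall_compl_eq_zero fun x hx =>
      image_eq_zero_of_notMem_tsupport fun h => hx (hg h)
  have hρ1 : ∫ x in Set.Ioo a c, ρ x = 1 := (toIoo ρ hρsub).trans b.integral_normed
  refine ⟨∫ x in Set.Ioo a c, H x * ρ x, ?_⟩
  have hmul : ∀ g : ℝ → ℝ, Continuous g → IntegrableOn (fun x => H x * g x) (Set.Ioo a c) :=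
    fun g hg => hH.mul_continuousOn_of_subset hg.continuousOn measurableSet_Ioo isCompact_Icc
      Set.Ioo_subset_Icc_self
  have hint : ∀ g : ℝ → ℝ, Continuous g → IntegrableOn g (Set.Ioo a c) := fun g hg =>
    (hg.integrableOn_Icc (a := a) (b := c)).mono_set Set.Ioo_subset_Icc_self
  have key := isOpen_Ioo.ae_eq_zero_of_integral_contDiff_smul_eq_zero (μ := volume)
    (f := fun x => H x - ∫ x in Set.Ioo a c, H x * ρ x)
    (U := Set.Ioo a c)
    (IntegrableOn.locallyIntegrableOn (hH.sub (integrableOn_const (by simp)))) ?_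
  · filter_upwards [key] with x hx hxm
    exact sub_eq_zero.1 (hx hxm)
  · intro η hη hηs hηsub
    set m := ∫ x in Set.Ioo a c, η x with hm
    have hsub' : tsupport (fun x => η x - m * ρ x) ⊆ Set.Ioo a c := by
      refine (closure_minimal (s := Function.support _) (t := tsupport η ∪ tsupport ρ) ?_
        ((isClosed_tsupport _).union (isClosed_tsupport _))).trans
          (Set.union_subset hηsub hρsub)
      intro x hx
      by_contra hx'
      simp only [Set.mem_union, not_or] at hx'
      apply hx
      simp [image_eq_zero_of_notMem_tsupport hx'.1, image_eq_zero_of_notMem_tsupport hx'.2]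
    obtain ⟨ζ, h1, h2, h3, h4⟩ := exists_primitive_of_integral_eq_zero hac
      (θ := fun x => η x - m * ρ x) (hη.sub (contDiff_const.mul hρ))
      (hηs.sub (hρs.mul_left (f := fun _ => m))) hsub' (by
        rw [← setIntegral_Ioo_eq_intervalIntegral hac.le,
          integral_sub (hint _ hη.continuous) ((hint _ hρ.continuous).const_mul m),
          integral_const_mul, hρ1, ← hm]
        ring)
    have h5 := h ζ h1 h2 h3
    rw [h4] at h5
    have h6 : ∫ x in Set.Ioo a c, H x * (η x - m * ρ x) =
        (∫ x in Set.Ioo a c, H x * η x) - m * ∫ x in Set.Ioo a c, H x * ρ x := by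
      rw [← integral_const_mul, ← integral_sub (hmul _ hη.continuous)
        ((hmul _ hρ.continuous).const_mul m)]
      congr 1
      ext x
      ring
    have h7 : ∫ x, η x • (H x - ∫ x in Set.Ioo a c, H x * ρ x) =
        ∫ x in Set.Ioo a c, η x • (H x - ∫ x in Set.Ioo a c, H x * ρ x) :=
      (toIoo _ ((tsupport_smul_subset_left _ _).trans hηsub)).symm
    have h8 : ∫ x in Set.Ioo a c, η x • (H x - ∫ x in Set.Ioo a c, H x * ρ x) =
        (∫ x in Set.Ioo a c, H x * η x) - (∫ x in Set.Ioo a c, H x * ρ x) * m := by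
      rw [hm, ← integral_const_mul, ← integral_sub (hmul _ hη.continuous)
        ((hint _ hη.continuous).const_mul _)]
      congr 1
      ext x
      simp only [smul_eq_mul]
      ring
    rw [h7, h8]
    linarith

/-- A function with a weak derivative on an interval satisfies integration by parts with respect
to its trace function `T`. -/
theorem exists_trace_of_weakDeriv_Ioo {P Q : ℝ → ℝ} {a c : ℝ} (hac : a < c)
    (hP : IntegrableOn P (Set.Ioo a c)) (hQ : IntegrableOn Q (Set.Ioo a c))
    (h : ∀ η : ℝ → ℝ, ContDiff ℝ ∞ η → HasCompactSupport η → tsupport η ⊆ Set.Ioo a c →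
      ∫ x in Set.Ioo a c, P x * deriv η x = -∫ x in Set.Ioo a c, Q x * η x) :
    ∃ T : ℝ → ℝ, ∀ s t, a ≤ s → s ≤ t → t ≤ c → ∀ ψ : ℝ → ℝ, ContDiff ℝ 1 ψ →
      ∫ x in Set.Ioo s t, (P x * deriv ψ x + Q x * ψ x) = T t * ψ t - T s * ψ s := by
  have hQi : IntervalIntegrable Q volume a c := by
    rw [intervalIntegrable_iff_integrableOn_Ioo_of_le hac.le]
    exact hQ
  let F : ℝ → ℝ := fun x => ∫ t in a..x, Q t
  have hF : AbsolutelyContinuousOnInterval F a c :=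
    hQi.absolutelyContinuousOnInterval_intervalIntegral (by simp)
  have hFd : ∀ᵐ x, x ∈ Set.Ioo a c → deriv F x = Q x := by
    filter_upwards [hQi.ae_hasDerivAt_integral] with x hx hxm
    exact (hx (Set.Icc_subset_uIcc (Set.Ioo_subset_Icc_self hxm)) a (by simp)).deriv
  have ibp : ∀ K : ℝ, ∀ s t, a ≤ s → s ≤ t → t ≤ c → ∀ ψ : ℝ → ℝ, ContDiff ℝ 1 ψ →
      ∫ x in Set.Ioo s t, ((F x + K) * deriv ψ x + Q x * ψ x) =
        (F t + K) * ψ t - (F s + K) * ψ s := by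
    intro K s t hs hst ht ψ hψ
    have hFst : AbsolutelyContinuousOnInterval (fun x => F x + K) s t :=
      (hF.mono (by
        rw [Set.uIcc_of_le hst, Set.uIcc_of_le hac.le]
        exact Set.Icc_subset_Icc hs ht)).fun_add
          (contDiffOn_const.absolutelyContinuousOnInterval)
    rw [← AbsolutelyContinuousOnInterval.integral_deriv_mul_eq_sub hFst
      (hψ.contDiffOn.absolutelyContinuousOnInterval), ← setIntegral_Ioo_eq_intervalIntegral hst]
    refine setIntegral_congr_ae measurableSet_Ioo ?_
    filter_upwards [hFd] with x hx hxm
    rw [deriv_add_const, hx ⟨hs.trans_lt hxm.1, hxm.2.trans_le ht⟩]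
    ring
  have hFi : IntegrableOn F (Set.Ioo a c) := by
    have := hF.continuousOn
    rw [Set.uIcc_of_le hac.le] at this
    exact this.integrableOn_Icc.mono_set Set.Ioo_subset_Icc_self
  have hmul : ∀ H : ℝ → ℝ, IntegrableOn H (Set.Ioo a c) → ∀ g : ℝ → ℝ, Continuous g →
      IntegrableOn (fun x => H x * g x) (Set.Ioo a c) := fun H hH g hg =>
    hH.mul_continuousOn_of_subset hg.continuousOn measurableSet_Ioo isCompact_Icc
      Set.Ioo_subset_Icc_self
  obtain ⟨C, hC⟩ := ae_eq_const_of_integral_mul_deriv_eq_zero (H := fun x => P x - F x) hac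
    (hP.sub hFi) (by
      intro η hη hηs hηsub
      have hη1 : ContDiff ℝ 1 η := hη.of_le (by exact_mod_cast le_top)
      have hdc : Continuous (deriv η) := hη1.continuous_deriv le_rfl
      have e1 := h η hη hηs hηsub
      have e2 := ibp 0 a c le_rfl hac.le le_rfl η hη1
      have ha : η a = 0 := image_eq_zero_of_notMem_tsupport fun h => lt_irrefl _ (hηsub h).1
      have hc : η c = 0 := image_eq_zero_of_notMem_tsupport fun h => lt_irrefl _ (hηsub h).2
      simp only [add_zero, ha, hc, mul_zero, sub_zero] at e2
      rw [integral_add (hmul F hFi _ hdc) (hmul Q hQ _ hη.continuous)] at e2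
      simp only [sub_mul]
      rw [integral_sub (hmul P hP _ hdc) (hmul F hFi _ hdc)]
      linarith)
  refine ⟨fun x => F x + C, fun s t hs hst ht ψ hψ => ?_⟩
  rw [← ibp C s t hs hst ht ψ hψ]
  refine setIntegral_congr_ae measurableSet_Ioo ?_
  filter_upwards [hC] with x hx hxm
  rw [← hx ⟨hs.trans_lt hxm.1, hxm.2.trans_le ht⟩]
  ring

theorem tsupport_mul_fst_snd_subset (η χ : ℝ → ℝ) :
    tsupport (fun z : ℝ × ℝ => η z.1 * χ z.2) ⊆ tsupport η ×ˢ tsupport χ := by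
  refine closure_minimal ?_ ((isClosed_tsupport _).prod (isClosed_tsupport _))
  intro z hz
  have hz' : η z.1 * χ z.2 ≠ 0 := hz
  exact ⟨subset_tsupport _ (left_ne_zero_of_mul hz'), subset_tsupport _ (right_ne_zero_of_mul hz')⟩

theorem isTestFunction_mul_fst_snd {η χ : ℝ → ℝ} {s t : Set ℝ} (hη : ContDiff ℝ ∞ η)
    (hηs : HasCompactSupport η) (hηsub : tsupport η ⊆ s) (hχ : ContDiff ℝ ∞ χ)
    (hχs : HasCompactSupport χ) (hχsub : tsupport χ ⊆ t) :
    IsTestFunction (s ×ˢ t) (fun z => η z.1 * χ z.2) :=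
  ⟨(hη.comp contDiff_fst).mul (hχ.comp contDiff_snd),
    (hηs.isCompact.prod hχs.isCompact).of_isClosed_subset (isClosed_tsupport _)
      (tsupport_mul_fst_snd_subset η χ),
    (tsupport_mul_fst_snd_subset η χ).trans (Set.prod_mono hηsub hχsub)⟩

theorem pdx_mul_fst_snd {η χ : ℝ → ℝ} (hη : Differentiable ℝ η) (hχ : Differentiable ℝ χ)
    (z : ℝ × ℝ) : pdx (fun z => η z.1 * χ z.2) z = deriv η z.1 * χ z.2 := by
  have h1 : HasFDerivAt (fun z : ℝ × ℝ => η z.1) _ z :=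
    (hη z.1).hasDerivAt.comp_hasFDerivAt z (ContinuousLinearMap.fst ℝ ℝ ℝ).hasFDerivAt
  have h2 : HasFDerivAt (fun z : ℝ × ℝ => χ z.2) _ z :=
    (hχ z.2).hasDerivAt.comp_hasFDerivAt z (ContinuousLinearMap.snd ℝ ℝ ℝ).hasFDerivAt
  have h3 : HasFDerivAt (fun z : ℝ × ℝ => η z.1 * χ z.2) _ z := h1.mul h2
  rw [pdx, h3.fderiv]
  simp [mul_comm]

/-- `q` is the weak derivative of `p` with respect to the first variable. -/
def IsWeakDx (Ω : Set (ℝ × ℝ)) (p q : ℝ × ℝ → ℝ) : Prop :=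
  ∀ φ, IsTestFunction Ω φ → ∫ z in Ω, p z * pdx φ z = -∫ z in Ω, q z * φ z

/-- `q` is the weak derivative of `p` with respect to the second variable. -/
def IsWeakDy (Ω : Set (ℝ × ℝ)) (p q : ℝ × ℝ → ℝ) : Prop :=
  ∀ φ, IsTestFunction Ω φ → ∫ z in Ω, p z * pdy φ z = -∫ z in Ω, q z * φ z

theorem IntegrableOn.mul_fst_snd {p : ℝ × ℝ → ℝ} {a c y₀ y₁ : ℝ}
    (hp : IntegrableOn p (Set.Ioo a c ×ˢ Set.Ioo y₀ y₁)) {η χ : ℝ → ℝ} (hη : Continuous η)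
    (hχ : Continuous χ) :
    IntegrableOn (fun z => p z * (η z.1 * χ z.2)) (Set.Ioo a c ×ˢ Set.Ioo y₀ y₁) :=
  hp.mul_continuousOn_of_subset (K := Set.Icc a c ×ˢ Set.Icc y₀ y₁)
    ((hη.comp continuous_fst).mul (hχ.comp continuous_snd)).continuousOn
    (measurableSet_Ioo.prod measurableSet_Ioo) (isCompact_Icc.prod isCompact_Icc)
    (Set.prod_mono Set.Ioo_subset_Icc_self Set.Ioo_subset_Icc_self)

/-- A function with a weak derivative in the first variable on a rectangle satisfies integration
by parts in that variable on all full-height sub-rectangles, with boundary terms given by a trace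
function `T`. -/
theorem exists_trace_fst {p q : ℝ × ℝ → ℝ} {a c y₀ y₁ : ℝ} (hac : a < c)
    (hp : IntegrableOn p (Set.Ioo a c ×ˢ Set.Ioo y₀ y₁))
    (hq : IntegrableOn q (Set.Ioo a c ×ˢ Set.Ioo y₀ y₁))
    (h : IsWeakDx (Set.Ioo a c ×ˢ Set.Ioo y₀ y₁) p q) {χ : ℝ → ℝ} (hχ : Continuous χ) :
    ∃ T : ℝ → ℝ, ∀ s t, a ≤ s → s ≤ t → t ≤ c → ∀ ψ : ℝ → ℝ, ContDiff ℝ 1 ψ →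
      ∫ z in Set.Ioo s t ×ˢ Set.Ioo y₀ y₁, (p z * deriv ψ z.1 + q z * ψ z.1) * χ z.2 =
        T t * ψ t - T s * ψ s := by
  have c1 : Continuous (fun _ : ℝ => (1 : ℝ)) := continuous_const
  have slice : ∀ r : ℝ × ℝ → ℝ, IntegrableOn r (Set.Ioo a c ×ˢ Set.Ioo y₀ y₁) →
      IntegrableOn (fun x => ∫ y in Set.Ioo y₀ y₁, r (x, y) * χ y) (Set.Ioo a c) := by
    intro r hr
    have h1 := IntegrableOn.mul_fst_snd hr c1 hχ
    rw [IntegrableOn, Measure.volume_eq_prod, ← Measure.prod_restrict] at h1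
    simpa [IntegrableOn] using h1.integral_prod_left
  have fub : ∀ r : ℝ × ℝ → ℝ, IntegrableOn r (Set.Ioo a c ×ˢ Set.Ioo y₀ y₁) → ∀ s t, a ≤ s →
      t ≤ c → ∀ η : ℝ → ℝ, Continuous η → ∀ χ' : ℝ → ℝ, Continuous χ' →
      ∫ z in Set.Ioo s t ×ˢ Set.Ioo y₀ y₁, r z * (η z.1 * χ' z.2) =
        ∫ x in Set.Ioo s t, (∫ y in Set.Ioo y₀ y₁, r (x, y) * χ' y) * η x := by
    intro r hr s t hs ht η hη χ' hχ'
    have h1 : IntegrableOn (fun z => r z * (η z.1 * χ' z.2)) (Set.Ioo s t ×ˢ Set.Ioo y₀ y₁) :=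
      (IntegrableOn.mul_fst_snd hr hη hχ').mono_set
        (Set.prod_mono (Set.Ioo_subset_Ioo hs ht) subset_rfl)
    rw [Measure.volume_eq_prod, setIntegral_prod _ h1]
    congr 1
    ext x
    rw [← integral_mul_const]
    congr 1
    ext y
    ring
  have fub' : ∀ r : ℝ × ℝ → ℝ, IntegrableOn r (Set.Ioo a c ×ˢ Set.Ioo y₀ y₁) →
      ∀ η : ℝ → ℝ, Continuous η → 
      IntegrableOn (fun y => ∫ x in Set.Ioo a c, r (x, y) * η x) (Set.Ioo y₀ y₁) ∧
      ∀ χ' : ℝ → ℝ, Continuous χ' →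
      ∫ z in Set.Ioo a c ×ˢ Set.Ioo y₀ y₁, r z * (η z.1 * χ' z.2) =
        ∫ y in Set.Ioo y₀ y₁, (∫ x in Set.Ioo a c, r (x, y) * η x) * χ' y := by
    intro r hr η hη
    constructor
    · have h1 := IntegrableOn.mul_fst_snd hr hη c1
      rw [IntegrableOn, Measure.volume_eq_prod, ← Measure.prod_restrict] at h1
      simpa [IntegrableOn] using h1.integral_prod_right
    · intro χ' hχ'
      have h1 := IntegrableOn.mul_fst_snd hr hη hχ'
      rw [IntegrableOn, Measure.volume_eq_prod, ← Measure.prod_restrict] at h1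
      rw [Measure.volume_eq_prod, ← Measure.prod_restrict, integral_prod_symm _ h1]
      congr 1
      ext y
      rw [← integral_mul_const]
      congr 1
      ext x
      ring
  obtain ⟨T, hT⟩ := exists_trace_of_weakDeriv_Ioo hac (slice p hp) (slice q hq) (by
    intro η hη hηs hηsub
    have hη1 : ContDiff ℝ 1 η := hη.of_le (by exact_mod_cast le_top)
    have hdc : Continuous (deriv η) := hη1.continuous_deriv le_rfl
    obtain ⟨ip, fp⟩ := fub' p hp _ hdc
    obtain ⟨iq, fq⟩ := fub' q hq _ hη.continuous
    rw [← fub p hp a c le_rfl le_rfl _ hdc _ hχ, ← fub q hq a c le_rfl le_rfl _ hη.continuous _ hχ,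
      fp χ hχ, fq χ hχ]
    have key := isOpen_Ioo.ae_eq_zero_of_integral_contDiff_smul_eq_zero (μ := volume)
      (f := fun y => (∫ x in Set.Ioo a c, p (x, y) * deriv η x) +
        ∫ x in Set.Ioo a c, q (x, y) * η x) (U := Set.Ioo y₀ y₁)
      (IntegrableOn.locallyIntegrableOn (ip.add iq)) (by
        intro χ' hχ' hχs hχsub
        have h1 := h _ (isTestFunction_mul_fst_snd hη hηs hηsub hχ' hχs hχsub)
        simp only [pdx_mul_fst_snd (hη1.differentiable (by simp))
          (hχ'.differentiable (by simp))] at h1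
        rw [fp χ' hχ'.continuous, fq χ' hχ'.continuous] at h1
        rw [← setIntegral_eq_integral_of_forall_compl_eq_zero (s := Set.Ioo y₀ y₁)]
        · have m1 : ∀ g : ℝ → ℝ, IntegrableOn g (Set.Ioo y₀ y₁) →
              IntegrableOn (fun y => g y * χ' y) (Set.Ioo y₀ y₁) := fun g hg =>
            hg.mul_continuousOn_of_subset hχ'.continuous.continuousOn measurableSet_Ioo
              isCompact_Icc Set.Ioo_subset_Icc_self
          simp only [smul_eq_mul, mul_comm (χ' _), add_mul]
          rw [integral_add (m1 _ ip) (m1 _ iq), h1]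
          ring
        · intro y hy
          simp [image_eq_zero_of_notMem_tsupport fun hh => hy (hχsub hh)])
    rw [← integral_neg]
    refine setIntegral_congr_ae measurableSet_Ioo ?_
    filter_upwards [key] with y hy hym
    have := hy hym
    rw [← neg_mul, eq_neg_of_add_eq_zero_left this])
  refine ⟨T, fun s t hs hst ht ψ hψ => ?_⟩
  rw [← hT s t hs hst ht ψ hψ]
  have hd : Continuous (deriv ψ) := hψ.continuous_deriv le_rfl
  have sl : ∀ r : ℝ × ℝ → ℝ, IntegrableOn r (Set.Ioo a c ×ˢ Set.Ioo y₀ y₁) → ∀ η : ℝ → ℝ,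
      Continuous η → IntegrableOn (fun x => (∫ y in Set.Ioo y₀ y₁, r (x, y) * χ y) * η x)
        (Set.Ioo s t) := fun r hr η hη =>
    ((slice r hr).mono_set (Set.Ioo_subset_Ioo hs ht)).mul_continuousOn_of_subset hη.continuousOn
      measurableSet_Ioo isCompact_Icc Set.Ioo_subset_Icc_self
  rw [integral_add (sl p hp _ hd) (sl q hq _ hψ.continuous),
    ← fub p hp s t hs ht _ hd _ hχ, ← fub q hq s t hs ht _ hψ.continuous _ hχ, ← integral_add]
  · congr 1
    ext z
    ring
  · exact (IntegrableOn.mul_fst_snd hp hd hχ).mono_set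
      (Set.prod_mono (Set.Ioo_subset_Ioo hs ht) subset_rfl)
  · exact (IntegrableOn.mul_fst_snd hq hψ.continuous hχ).mono_set
      (Set.prod_mono (Set.Ioo_subset_Ioo hs ht) subset_rfl)

theorem pdy_comp_swap {φ : ℝ × ℝ → ℝ} (hφ : Differentiable ℝ φ) (z : ℝ × ℝ) :
    pdy (fun z => φ z.swap) z = pdx φ z.swap := by
  have h1 : HasFDerivAt (fun z : ℝ × ℝ => φ z.swap) _ z :=
    (hφ z.swap).hasFDerivAt.comp z
      ((ContinuousLinearEquiv.prodComm ℝ ℝ ℝ : (ℝ × ℝ) →L[ℝ] (ℝ × ℝ)).hasFDerivAt)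
  simp [pdx, pdy, h1.fderiv]

theorem IsTestFunction.comp_swap {s t : Set ℝ} {φ : ℝ × ℝ → ℝ} (h : IsTestFunction (s ×ˢ t) φ) :
    IsTestFunction (t ×ˢ s) (fun z => φ z.swap) := by
  have e : tsupport (fun z : ℝ × ℝ => φ z.swap) = Prod.swap ⁻¹' tsupport φ :=
    tsupport_comp_eq_preimage φ (Homeomorph.prodComm ℝ ℝ)
  refine ⟨h.1.comp (contDiff_snd.prodMk contDiff_fst),
    h.2.1.comp_homeomorph (Homeomorph.prodComm ℝ ℝ), ?_⟩
  rw [e]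
  intro z hz
  exact ⟨(h.2.2 hz).2, (h.2.2 hz).1⟩

theorem exists_trace_snd {p q : ℝ × ℝ → ℝ} {a c x₀ x₁ : ℝ} (hac : a < c)
    (hp : IntegrableOn p (Set.Ioo x₀ x₁ ×ˢ Set.Ioo a c))
    (hq : IntegrableOn q (Set.Ioo x₀ x₁ ×ˢ Set.Ioo a c))
    (h : IsWeakDy (Set.Ioo x₀ x₁ ×ˢ Set.Ioo a c) p q) {χ : ℝ → ℝ} (hχ : Continuous χ) :
    ∃ T : ℝ → ℝ, ∀ s t, a ≤ s → s ≤ t → t ≤ c → ∀ ψ : ℝ → ℝ, ContDiff ℝ 1 ψ →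
      ∫ z in Set.Ioo x₀ x₁ ×ˢ Set.Ioo s t, (p z * deriv ψ z.2 + q z * ψ z.2) * χ z.1 =
        T t * ψ t - T s * ψ s := by
  have swap : ∀ (s t : Set ℝ) (g : ℝ × ℝ → ℝ),
      ∫ z in t ×ˢ s, g z.swap = ∫ z in s ×ˢ t, g z := fun s t g => setIntegral_prod_swap s t g
  have hi : ∀ r : ℝ × ℝ → ℝ, IntegrableOn r (Set.Ioo x₀ x₁ ×ˢ Set.Ioo a c) →
      IntegrableOn (fun z => r z.swap) (Set.Ioo a c ×ˢ Set.Ioo x₀ x₁) := by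
    intro r hr
    rw [IntegrableOn, Measure.volume_eq_prod, ← Measure.prod_restrict] at hr ⊢
    exact hr.swap
  obtain ⟨T, hT⟩ := exists_trace_fst hac (hi p hp) (hi q hq) (by
    intro φ hφ
    have h1 := h _ hφ.comp_swap
    rw [← swap, ← swap (Set.Ioo x₀ x₁) (Set.Ioo a c)] at h1
    simpa [pdy_comp_swap (hφ.1.differentiable (by simp))] using h1) hχ
  refine ⟨T, fun s t hs hst ht ψ hψ => ?_⟩
  rw [← hT s t hs hst ht ψ hψ, ← swap]
  rfl

/-! ### Classical and weak derivatives -/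

theorem contDiff_pdx {v : ℝ × ℝ → ℝ} (h : ContDiff ℝ ∞ v) : ContDiff ℝ ∞ (pdx v) :=
  (h.fderiv_right (m := ∞) (by simp)).clm_apply contDiff_const

theorem contDiff_pdy {v : ℝ × ℝ → ℝ} (h : ContDiff ℝ ∞ v) : ContDiff ℝ ∞ (pdy v) :=
  (h.fderiv_right (m := ∞) (by simp)).clm_apply contDiff_const

theorem pdy_pdx_comm {v : ℝ × ℝ → ℝ} (h : ContDiff ℝ ∞ v) : pdy (pdx v) = pdx (pdy v) := by
  funext z
  have hd : DifferentiableAt ℝ (fderiv ℝ v) z :=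
    (h.fderiv_right (m := ∞) (by simp)).differentiable (by simp) z
  have e : ∀ a b : ℝ × ℝ, fderiv ℝ (fun z => fderiv ℝ v z a) z b = fderiv ℝ (fderiv ℝ v) z b a := by
    intro a b
    rw [fderiv_clm_apply hd (differentiableAt_const a)]
    simp
  change fderiv ℝ (fun z => fderiv ℝ v z (1, 0)) z (0, 1) =
    fderiv ℝ (fun z => fderiv ℝ v z (0, 1)) z (1, 0)
  rw [e, e]
  exact (h.contDiffAt.isSymmSndFDerivAt
    (by simpa using WithTop.coe_le_coe.2 (le_top : (2 : ℕ∞) ≤ ⊤))) _ _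

theorem contDiff_pdx_iterate {v : ℝ × ℝ → ℝ} (h : ContDiff ℝ ∞ v) (n : ℕ) :
    ContDiff ℝ ∞ (pdx^[n] v) := by
  induction n with
  | zero => exact h
  | succ n ih => rw [Function.iterate_succ_apply']; exact contDiff_pdx ih

theorem contDiff_pdy_iterate {v : ℝ × ℝ → ℝ} (h : ContDiff ℝ ∞ v) (n : ℕ) :
    ContDiff ℝ ∞ (pdy^[n] v) := by
  induction n with
  | zero => exact h
  | succ n ih => rw [Function.iterate_succ_apply']; exact contDiff_pdy ih

theorem contDiff_partialDeriv {v : ℝ × ℝ → ℝ} (h : ContDiff ℝ ∞ v) (α : ℕ × ℕ) :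
    ContDiff ℝ ∞ (partialDeriv α v) :=
  contDiff_pdx_iterate (contDiff_pdy_iterate h _) _

theorem pdy_iterate_pdx {v : ℝ × ℝ → ℝ} (h : ContDiff ℝ ∞ v) (n : ℕ) :
    pdy^[n] (pdx v) = pdx (pdy^[n] v) := by
  induction n with
  | zero => rfl
  | succ n ih =>
    rw [Function.iterate_succ_apply', ih, Function.iterate_succ_apply',
      pdy_pdx_comm (contDiff_pdy_iterate h n)]

theorem pdy_iterate_pdx_iterate {v : ℝ × ℝ → ℝ} (h : ContDiff ℝ ∞ v) (m n : ℕ) :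
    pdy^[n] (pdx^[m] v) = pdx^[m] (pdy^[n] v) := by
  induction m with
  | zero => rfl
  | succ m ih =>
    rw [Function.iterate_succ_apply', pdy_iterate_pdx (contDiff_pdx_iterate h m), ih,
      Function.iterate_succ_apply']

theorem partialDeriv_pdx {v : ℝ × ℝ → ℝ} (h : ContDiff ℝ ∞ v) (α : ℕ × ℕ) :
    partialDeriv α (pdx v) = partialDeriv (α + (1, 0)) v := by
  simp only [partialDeriv, Prod.fst_add, Prod.snd_add, add_zero]
  rw [pdy_iterate_pdx h, ← Function.iterate_succ_apply]

theorem partialDeriv_pdy (v : ℝ × ℝ → ℝ) (α : ℕ × ℕ) :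
    partialDeriv α (pdy v) = partialDeriv (α + (0, 1)) v := by
  simp only [partialDeriv, Prod.fst_add, Prod.snd_add, add_zero]
  rw [← Function.iterate_succ_apply]

theorem tsupport_pdx_subset (v : ℝ × ℝ → ℝ) : tsupport (pdx v) ⊆ tsupport v :=
  tsupport_fderiv_apply_subset ℝ _

theorem tsupport_pdy_subset (v : ℝ × ℝ → ℝ) : tsupport (pdy v) ⊆ tsupport v :=
  tsupport_fderiv_apply_subset ℝ _

namespace IsTestFunction

variable {Ω : Set (ℝ × ℝ)} {φ : ℝ × ℝ → ℝ}

theorem pdx (h : IsTestFunction Ω φ) : IsTestFunction Ω (pdx φ) :=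
  ⟨contDiff_pdx h.1, h.2.1.isCompact.of_isClosed_subset (isClosed_tsupport _)
    (tsupport_pdx_subset φ), (tsupport_pdx_subset φ).trans h.2.2⟩

theorem pdy (h : IsTestFunction Ω φ) : IsTestFunction Ω (pdy φ) :=
  ⟨contDiff_pdy h.1, h.2.1.isCompact.of_isClosed_subset (isClosed_tsupport _)
    (tsupport_pdy_subset φ), (tsupport_pdy_subset φ).trans h.2.2⟩

theorem partialDeriv (h : IsTestFunction Ω φ) (α : ℕ × ℕ) :
    IsTestFunction Ω (partialDeriv α φ) := by
  have h1 : ∀ n, IsTestFunction Ω (RectMorley.pdy^[n] φ) := by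
    intro n
    induction n with
    | zero => exact h
    | succ n ih => rw [Function.iterate_succ_apply']; exact ih.pdy
  have h2 : ∀ n, IsTestFunction Ω (RectMorley.pdx^[n] (RectMorley.pdy^[α.2] φ)) := by
    intro n
    induction n with
    | zero => exact h1 _
    | succ n ih => rw [Function.iterate_succ_apply']; exact ih.pdx
  exact h2 _

theorem mono {Ω' : Set (ℝ × ℝ)} (h : IsTestFunction Ω φ) (hs : Ω ⊆ Ω') : IsTestFunction Ω' φ :=
  ⟨h.1, h.2.1, h.2.2.trans hs⟩

theorem eq_zero_of_notMem (h : IsTestFunction Ω φ) {z : ℝ × ℝ} (hz : z ∉ Ω) : φ z = 0 :=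
  image_eq_zero_of_notMem_tsupport fun h' => hz (h.2.2 h')

theorem setIntegral_mul (h : IsTestFunction Ω φ) (g : ℝ × ℝ → ℝ) :
    ∫ z in Ω, g z * φ z = ∫ z, g z * φ z :=
  setIntegral_eq_integral_of_forall_compl_eq_zero fun z hz => by simp [h.eq_zero_of_notMem hz]

theorem setIntegral_mul_mono {Ω' : Set (ℝ × ℝ)} (h : IsTestFunction Ω φ) (hs : Ω ⊆ Ω')
    (g : ℝ × ℝ → ℝ) : ∫ z in Ω', g z * φ z = ∫ z in Ω, g z * φ z := by
  rw [h.setIntegral_mul, (h.mono hs).setIntegral_mul]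

theorem integrable_mul {g : ℝ × ℝ → ℝ} (h : IsTestFunction Ω φ) (hg : Continuous g) :
    Integrable (fun z => g z * φ z) :=
  (hg.mul h.1.continuous).integrable_of_hasCompactSupport (h.2.1.mul_left)

theorem memLp (h : IsTestFunction Ω φ) : MemL2 Ω φ :=
  (h.1.continuous.memLp_of_hasCompactSupport h.2.1).restrict Ω

theorem integrableOn_mul (h : IsTestFunction Ω φ) {g : ℝ × ℝ → ℝ} (hg : MemL2 Ω g) :
    IntegrableOn (fun z => g z * φ z) Ω :=
  MemLp.integrable_mul hg h.memLp

end IsTestFunction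

theorem integral_mul_partialDeriv {Ω : Set (ℝ × ℝ)} {v φ : ℝ × ℝ → ℝ} (hv : ContDiff ℝ ∞ v)
    (hφ : IsTestFunction Ω φ) (α : ℕ × ℕ) :
    ∫ z, v z * partialDeriv α φ z = (-1) ^ (α.1 + α.2) * ∫ z, partialDeriv α v z * φ z := by
  have ex : ∀ {v φ : ℝ × ℝ → ℝ}, ContDiff ℝ ∞ v → IsTestFunction Ω φ →
      ∫ z, v z * pdx φ z = -∫ z, pdx v z * φ z := fun hv hφ =>
    integral_mul_fderiv_eq_neg_fderiv_mul_of_integrable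
      (hφ.integrable_mul (contDiff_pdx hv).continuous) (hφ.pdx.integrable_mul hv.continuous)
      (hφ.integrable_mul hv.continuous) (fun z _ => hv.differentiable (by simp) z)
      (fun z _ => hφ.1.differentiable (by simp) z)
  have ey : ∀ {v φ : ℝ × ℝ → ℝ}, ContDiff ℝ ∞ v → IsTestFunction Ω φ →
      ∫ z, v z * pdy φ z = -∫ z, pdy v z * φ z := fun hv hφ =>
    integral_mul_fderiv_eq_neg_fderiv_mul_of_integrable
      (hφ.integrable_mul (contDiff_pdy hv).continuous) (hφ.pdy.integrable_mul hv.continuous)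
      (hφ.integrable_mul hv.continuous) (fun z _ => hv.differentiable (by simp) z)
      (fun z _ => hφ.1.differentiable (by simp) z)
  have hy : ∀ (n : ℕ) {v φ : ℝ × ℝ → ℝ}, ContDiff ℝ ∞ v → IsTestFunction Ω φ →
      ∫ z, v z * pdy^[n] φ z = (-1) ^ n * ∫ z, pdy^[n] v z * φ z := by
    intro n
    induction n with
    | zero => intros; simp
    | succ n ih =>
      intro v φ hv hφ
      rw [Function.iterate_succ_apply, ih hv hφ.pdy, ey (contDiff_pdy_iterate hv n) hφ,
        Function.iterate_succ_apply', pow_succ]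
      ring
  have hx : ∀ (n : ℕ) {v φ : ℝ × ℝ → ℝ}, ContDiff ℝ ∞ v → IsTestFunction Ω φ →
      ∫ z, v z * pdx^[n] φ z = (-1) ^ n * ∫ z, pdx^[n] v z * φ z := by
    intro n
    induction n with
    | zero => intros; simp
    | succ n ih =>
      intro v φ hv hφ
      rw [Function.iterate_succ_apply, ih hv hφ.pdx, ex (contDiff_pdx_iterate hv n) hφ,
        Function.iterate_succ_apply', pow_succ]
      ring
  have e0 : IsTestFunction Ω (pdy^[α.2] φ) := hφ.partialDeriv (0, α.2)
  unfold partialDeriv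
  rw [hx _ hv e0, hy _ (contDiff_pdx_iterate hv _) hφ, pdy_iterate_pdx_iterate hv,
    pow_add, mul_assoc]

namespace IsWeakDeriv

variable {Ω : Set (ℝ × ℝ)} {α : ℕ × ℕ} {u g g' : ℝ × ℝ → ℝ}

theorem of_contDiff (Ω : Set (ℝ × ℝ)) (α : ℕ × ℕ) {v : ℝ × ℝ → ℝ} (hv : ContDiff ℝ ∞ v) :
    IsWeakDeriv Ω α v (partialDeriv α v) := by
  refine ⟨hv.continuous.locallyIntegrable.locallyIntegrableOn _,
    (contDiff_partialDeriv hv α).continuous.locallyIntegrable.locallyIntegrableOn _,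
    fun φ hφ => ?_⟩
  rw [(hφ.partialDeriv α).setIntegral_mul, hφ.setIntegral_mul, integral_mul_partialDeriv hv hφ]

theorem ae_eq (hΩ : IsOpen Ω) (h : IsWeakDeriv Ω α u g) (h' : IsWeakDeriv Ω α u g') :
    g =ᵐ[volume.restrict Ω] g' := by
  have key := hΩ.ae_eq_zero_of_integral_contDiff_smul_eq_zero (μ := volume)
    (f := fun z => g z - g' z) (h.2.1.sub h'.2.1) (by
      intro φ h1 h2 h3
      have hφ : IsTestFunction Ω φ := ⟨h1, h2, h3⟩
      have hi : ∀ g, LocallyIntegrableOn g Ω → Integrable (fun z => g z * φ z) := fun g hg =>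
        (integrableOn_iff_integrable_of_support_subset (s := tsupport φ) fun z hz =>
          subset_tsupport φ (right_ne_zero_of_mul (Function.mem_support.1 hz))).1
            ((hg.integrableOn_compact_subset h3 h2.isCompact).mul_continuousOn
              h1.continuous.continuousOn h2.isCompact)
      have e : (-1 : ℝ) ^ (α.1 + α.2) ≠ 0 := by simp
      have e1 := mul_left_cancel₀ e ((h.2.2 φ hφ).symm.trans (h'.2.2 φ hφ))
      rw [hφ.setIntegral_mul, hφ.setIntegral_mul] at e1
      have e2 : ∀ z, φ z • (g z - g' z) = g z * φ z - g' z * φ z := fun z => by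
        rw [smul_eq_mul]
        ring
      simp only [e2]
      rw [integral_sub (hi g h.2.1) (hi g' h'.2.1), e1, sub_self])
  rw [EventuallyEq, ae_restrict_iff' hΩ.measurableSet]
  filter_upwards [key] with z hz hzm
  exact sub_eq_zero.1 (hz hzm)

theorem mono {U : Set (ℝ × ℝ)} (h : IsWeakDeriv Ω α u g) (hU : U ⊆ Ω) : IsWeakDeriv U α u g := by
  refine ⟨h.1.mono_set hU, h.2.1.mono_set hU, fun φ hφ => ?_⟩
  rw [← (hφ.partialDeriv α).setIntegral_mul_mono hU, ← hφ.setIntegral_mul_mono hU]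
  exact h.2.2 φ (hφ.mono hU)

theorem congr {u' : ℝ × ℝ → ℝ} (h : IsWeakDeriv Ω α u g)
    (he : u' =ᵐ[volume.restrict Ω] u) (hu' : LocallyIntegrableOn u' Ω) :
    IsWeakDeriv Ω α u' g := by
  refine ⟨hu', h.2.1, fun φ hφ => ?_⟩
  rw [← h.2.2 φ hφ]
  refine integral_congr_ae ?_
  filter_upwards [he] with z hz
  rw [hz]

theorem isWeakDx (h : IsWeakDeriv Ω α u g) (h' : IsWeakDeriv Ω (α + (1, 0)) u g') :
    IsWeakDx Ω g g' := by
  intro φ hφ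
  have e1 := h.2.2 _ hφ.pdx
  have e2 := h'.2.2 _ hφ
  rw [partialDeriv_pdx hφ.1, e2] at e1
  have e : (-1 : ℝ) ^ (α.1 + α.2) ≠ 0 := by simp
  refine mul_left_cancel₀ e (e1.symm.trans ?_)
  simp only [Prod.fst_add, Prod.snd_add]
  ring

theorem isWeakDy (h : IsWeakDeriv Ω α u g) (h' : IsWeakDeriv Ω (α + (0, 1)) u g') :
    IsWeakDy Ω g g' := by
  intro φ hφ
  have e1 := h.2.2 _ hφ.pdy
  have e2 := h'.2.2 _ hφ
  rw [partialDeriv_pdy, e2] at e1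
  have e : (-1 : ℝ) ^ (α.1 + α.2) ≠ 0 := by simp
  refine mul_left_cancel₀ e (e1.symm.trans ?_)
  simp only [Prod.fst_add, Prod.snd_add]
  ring

theorem weakDeriv (h : IsWeakDeriv Ω α u g) : IsWeakDeriv Ω α u (weakDeriv Ω α u) := by
  have hex : ∃ g, IsWeakDeriv Ω α u g := ⟨g, h⟩
  unfold RectMorley.weakDeriv
  rw [dif_pos hex]
  exact hex.choose_spec

theorem weakDeriv_ae_eq (hΩ : IsOpen Ω) (h : IsWeakDeriv Ω α u g) :
    RectMorley.weakDeriv Ω α u =ᵐ[volume.restrict Ω] g :=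
  h.weakDeriv.ae_eq hΩ h

end IsWeakDeriv

theorem IsWeakDx.mono {Ω U : Set (ℝ × ℝ)} {p q : ℝ × ℝ → ℝ} (h : IsWeakDx Ω p q) (hU : U ⊆ Ω) :
    IsWeakDx U p q := fun φ hφ => by
  rw [← hφ.pdx.setIntegral_mul_mono hU, ← hφ.setIntegral_mul_mono hU]
  exact h φ (hφ.mono hU)

theorem IsWeakDy.mono {Ω U : Set (ℝ × ℝ)} {p q : ℝ × ℝ → ℝ} (h : IsWeakDy Ω p q) (hU : U ⊆ Ω) :
    IsWeakDy U p q := fun φ hφ => by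
  rw [← hφ.pdy.setIntegral_mul_mono hU, ← hφ.setIntegral_mul_mono hU]
  exact h φ (hφ.mono hU)

theorem integral_add_two_mul_add {X : Type*} [MeasurableSpace X] {μ : Measure X} {f g k : X → ℝ}
    (hf : Integrable f μ) (hg : Integrable g μ) (hk : Integrable k μ) :
    ∫ z, (f z + 2 * g z + k z) ∂μ = (∫ z, f z ∂μ) + 2 * (∫ z, g z ∂μ) + ∫ z, k z ∂μ := by
  have hfg : Integrable (fun z => f z + 2 * g z) μ := hf.add (hg.const_mul 2)
  rw [integral_add hfg hk, integral_add hf (hg.const_mul 2), integral_const_mul]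

theorem hessForm_congr {Ω : Set (ℝ × ℝ)} (hΩ : IsOpen Ω) {u v : ℝ × ℝ → ℝ}
    {gu gv : ℕ × ℕ → ℝ × ℝ → ℝ}
    (hu : ∀ α : ℕ × ℕ, α.1 + α.2 = 2 → IsWeakDeriv Ω α u (gu α))
    (hv : ∀ α : ℕ × ℕ, α.1 + α.2 = 2 → IsWeakDeriv Ω α v (gv α)) :
    hessForm Ω u v = ∫ z in Ω, (gu (2, 0) z * gv (2, 0) z + 2 * (gu (1, 1) z * gv (1, 1) z)
      + gu (0, 2) z * gv (0, 2) z) := by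
  refine integral_congr_ae ?_
  filter_upwards [(hu (2, 0) rfl).weakDeriv_ae_eq hΩ, (hu (1, 1) rfl).weakDeriv_ae_eq hΩ,
    (hu (0, 2) rfl).weakDeriv_ae_eq hΩ, (hv (2, 0) rfl).weakDeriv_ae_eq hΩ,
    (hv (1, 1) rfl).weakDeriv_ae_eq hΩ, (hv (0, 2) rfl).weakDeriv_ae_eq hΩ] with z h1 h2 h3 h4 h5 h6
  rw [h1, h2, h3, h4, h5, h6]

theorem MemH.isWeakDeriv {Ω : Set (ℝ × ℝ)} {m : ℕ} {u : ℝ × ℝ → ℝ} (h : MemH Ω m u) {α : ℕ × ℕ}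
    (hα : α.1 + α.2 ≤ m) : IsWeakDeriv Ω α u (weakDeriv Ω α u) := by
  obtain ⟨g, -, hg⟩ := h.2 α hα
  exact hg.weakDeriv

theorem MemH.memL2_weakDeriv {Ω : Set (ℝ × ℝ)} (hΩ : IsOpen Ω) {m : ℕ} {u : ℝ × ℝ → ℝ}
    (h : MemH Ω m u) {α : ℕ × ℕ} (hα : α.1 + α.2 ≤ m) : MemL2 Ω (weakDeriv Ω α u) := by
  obtain ⟨g, h1, hg⟩ := h.2 α hα
  exact (memLp_congr_ae (hg.weakDeriv_ae_eq hΩ)).2 h1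

theorem IsTestFunction.memH20 {Ω : Set (ℝ × ℝ)} (hΩ : IsOpen Ω) {φ : ℝ × ℝ → ℝ}
    (h : IsTestFunction Ω φ) : MemH20 Ω φ := by
  refine ⟨⟨h.memLp, fun α _ => ⟨RectMorley.partialDeriv α φ, (h.partialDeriv α).memLp,
    IsWeakDeriv.of_contDiff Ω α h.1⟩⟩, fun _ => φ, fun _ => h, fun α _ => ?_⟩
  have e : normL2 Ω (fun z => RectMorley.partialDeriv α φ z - weakDeriv Ω α φ z) = 0 := by
    unfold normL2
    rw [integral_eq_zero_of_ae, Real.sqrt_zero]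
    filter_upwards [(IsWeakDeriv.of_contDiff Ω α h.1).weakDeriv_ae_eq hΩ] with z hz
    simp [hz]
  exact (tendsto_congr fun _ => e).2 tendsto_const_nhds

/-- The strong form of the biharmonic equation for solutions in `H⁴`. -/
theorem IsBiharmonicSolution.ae_eq {Ω : Set (ℝ × ℝ)} (hΩ : IsOpen Ω) {f u : ℝ × ℝ → ℝ}
    (hf : LocallyIntegrableOn f Ω) (hf2 : MemL2 Ω f) (hu : MemH Ω 4 u)
    (h : IsBiharmonicSolution Ω f u) :
    f =ᵐ[volume.restrict Ω] fun z => weakDeriv Ω (4, 0) u z + 2 * weakDeriv Ω (2, 2) u z +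
      weakDeriv Ω (0, 4) u z := by
  have L2 : ∀ α : ℕ × ℕ, α.1 + α.2 ≤ 4 → MemL2 Ω (weakDeriv Ω α u) := fun α hα =>
    hu.memL2_weakDeriv hΩ hα
  have W : ∀ α : ℕ × ℕ, α.1 + α.2 ≤ 4 → IsWeakDeriv Ω α u (weakDeriv Ω α u) := fun α hα =>
    hu.isWeakDeriv hα
  have key := hΩ.ae_eq_zero_of_integral_contDiff_smul_eq_zero (μ := volume)
    (f := fun z => f z - (weakDeriv Ω (4, 0) u z + 2 * weakDeriv Ω (2, 2) u z +
      weakDeriv Ω (0, 4) u z))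
    (hf.sub ((((W (4, 0) (by simp)).2.1.add ((W (2, 2) (by simp)).2.1.smul (2 : ℝ)))).add
      (W (0, 4) (by simp)).2.1)) (by
      intro φ h1 h2 h3
      have hφ : IsTestFunction Ω φ := ⟨h1, h2, h3⟩
      have e := h.2 φ (hφ.memH20 hΩ)
      rw [hessForm_congr hΩ (gu := fun α => weakDeriv Ω α u) (gv := fun α => partialDeriv α φ)
        (fun α hα => W α (by omega)) (fun α _ => IsWeakDeriv.of_contDiff Ω α h1)] at e
      have i20 := (hφ.partialDeriv (2, 0)).integrableOn_mul (L2 (2, 0) (by simp))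
      have i11 := (hφ.partialDeriv (1, 1)).integrableOn_mul (L2 (1, 1) (by simp))
      have i02 := (hφ.partialDeriv (0, 2)).integrableOn_mul (L2 (0, 2) (by simp))
      have i40 := hφ.integrableOn_mul (L2 (4, 0) (by simp))
      have i22 := hφ.integrableOn_mul (L2 (2, 2) (by simp))
      have i04 := hφ.integrableOn_mul (L2 (0, 4) (by simp))
      have jf := hφ.integrableOn_mul hf2
      rw [integral_add_two_mul_add i20 i11 i02] at e
      have e20 : ∫ z in Ω, weakDeriv Ω (2, 0) u z * partialDeriv (2, 0) φ z =
          ∫ z in Ω, weakDeriv Ω (4, 0) u z * φ z := by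
        have a := (W (2, 0) (by simp)).isWeakDx (W (3, 0) (by simp)) _ hφ.pdx
        have b := (W (3, 0) (by simp)).isWeakDx (W (4, 0) (by simp)) _ hφ
        rw [b, neg_neg] at a
        exact a
      have e11 : ∫ z in Ω, weakDeriv Ω (1, 1) u z * partialDeriv (1, 1) φ z =
          ∫ z in Ω, weakDeriv Ω (2, 2) u z * φ z := by
        have a := (W (1, 1) (by simp)).isWeakDx (W (2, 1) (by simp)) _ hφ.pdy
        have b := (W (2, 1) (by simp)).isWeakDy (W (2, 2) (by simp)) _ hφ
        rw [b, neg_neg] at a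
        exact a
      have e02 : ∫ z in Ω, weakDeriv Ω (0, 2) u z * partialDeriv (0, 2) φ z =
          ∫ z in Ω, weakDeriv Ω (0, 4) u z * φ z := by
        have a := (W (0, 2) (by simp)).isWeakDy (W (0, 3) (by simp)) _ hφ.pdy
        have b := (W (0, 3) (by simp)).isWeakDy (W (0, 4) (by simp)) _ hφ
        rw [b, neg_neg] at a
        exact a
      rw [e20, e11, e02] at e
      have e5 : ∀ z, φ z • (f z - (weakDeriv Ω (4, 0) u z + 2 * weakDeriv Ω (2, 2) u z +
          weakDeriv Ω (0, 4) u z)) = (f z - (weakDeriv Ω (4, 0) u z + 2 * weakDeriv Ω (2, 2) u z +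
          weakDeriv Ω (0, 4) u z)) * φ z := fun z => by rw [smul_eq_mul, mul_comm]
      simp only [e5]
      rw [← hφ.setIntegral_mul]
      have e6 : ∫ z in Ω, (f z - (weakDeriv Ω (4, 0) u z + 2 * weakDeriv Ω (2, 2) u z +
          weakDeriv Ω (0, 4) u z)) * φ z = (∫ z in Ω, f z * φ z) -
          ((∫ z in Ω, weakDeriv Ω (4, 0) u z * φ z) + 2 * (∫ z in Ω, weakDeriv Ω (2, 2) u z * φ z)
          + ∫ z in Ω, weakDeriv Ω (0, 4) u z * φ z) := by
        have i3 : IntegrableOn (fun z => weakDeriv Ω (4, 0) u z * φ z +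
            2 * (weakDeriv Ω (2, 2) u z * φ z) + weakDeriv Ω (0, 4) u z * φ z) Ω :=
          (i40.add (i22.const_mul 2)).add i04
        rw [← integral_add_two_mul_add i40 i22 i04, ← integral_sub jf i3]
        congr 1
        ext z
        ring
      rw [e6, e, sub_self])
  rw [EventuallyEq, ae_restrict_iff' hΩ.measurableSet]
  filter_upwards [key] with z hz hzm
  exact sub_eq_zero.1 (hz hzm)

namespace UniformMesh

/-! ### Geometry of uniform meshes -/

variable (M : UniformMesh)

/-- Abscissa of the lattice points with first index `i`. -/
def node₁ (i : ℤ) : ℝ := M.origin.1 + 2 * M.h₁ * i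

/-- Ordinate of the lattice points with second index `j`. -/
def node₂ (j : ℤ) : ℝ := M.origin.2 + 2 * M.h₂ * j

/-- Interior of the cell with lower left corner `vertex k`. -/
def openCell (k : ℤ × ℤ) : Set (ℝ × ℝ) :=
  Set.Ioo (M.node₁ k.1) (M.node₁ (k.1 + 1)) ×ˢ Set.Ioo (M.node₂ k.2) (M.node₂ (k.2 + 1))

theorem vertex_eq (m : ℤ × ℤ) : M.vertex m = (M.node₁ m.1, M.node₂ m.2) := rfl

theorem node₁_add_one (i : ℤ) : M.node₁ (i + 1) = M.node₁ i + 2 * M.h₁ := by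
  simp only [node₁]; push_cast; ring

theorem node₂_add_one (j : ℤ) : M.node₂ (j + 1) = M.node₂ j + 2 * M.h₂ := by
  simp only [node₂]; push_cast; ring

theorem node₁_lt (i : ℤ) : M.node₁ i < M.node₁ (i + 1) := by
  rw [node₁_add_one]; linarith [M.h₁_pos]

theorem node₂_lt (j : ℤ) : M.node₂ j < M.node₂ (j + 1) := by
  rw [node₂_add_one]; linarith [M.h₂_pos]

theorem node₁_strictMono : StrictMono M.node₁ := strictMono_int_of_lt_succ M.node₁_lt

theorem node₂_strictMono : StrictMono M.node₂ := strictMono_int_of_lt_succ M.node₂_lt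

theorem cell_eq (k : ℤ × ℤ) : M.cell k =
    Set.Icc (M.node₁ k.1) (M.node₁ (k.1 + 1)) ×ˢ Set.Icc (M.node₂ k.2) (M.node₂ (k.2 + 1)) := by
  rw [cell, vertex_eq, vertex_eq, Set.Icc_prod_eq]
  rfl

theorem interior_cell (k : ℤ × ℤ) : interior (M.cell k) = M.openCell k := by
  rw [cell_eq, interior_prod_eq, interior_Icc, interior_Icc, openCell]

theorem isOpen_openCell (k : ℤ × ℤ) : IsOpen (M.openCell k) := isOpen_Ioo.prod isOpen_Ioo

theorem closure_openCell (k : ℤ × ℤ) : closure (M.openCell k) = M.cell k := by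
  rw [cell_eq, openCell, closure_prod_eq, closure_Ioo (M.node₁_lt _).ne,
    closure_Ioo (M.node₂_lt _).ne]

theorem openCell_subset_cell (k : ℤ × ℤ) : M.openCell k ⊆ M.cell k := by
  rw [← closure_openCell]
  exact subset_closure

theorem eq_of_mem_openCell_of_mem_cell {j k : ℤ × ℤ} {z : ℝ × ℝ} (hj : z ∈ M.openCell j)
    (hk : z ∈ M.cell k) : j = k := by
  rw [cell_eq] at hk
  obtain ⟨⟨a1, a2⟩, b1, b2⟩ := hj
  obtain ⟨⟨c1, c2⟩, d1, d2⟩ := hk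
  have e1 := M.node₁_strictMono.lt_iff_lt.1 (c1.trans_lt a2)
  have e2 := M.node₁_strictMono.lt_iff_lt.1 (a1.trans_le c2)
  have e3 := M.node₂_strictMono.lt_iff_lt.1 (d1.trans_lt b2)
  have e4 := M.node₂_strictMono.lt_iff_lt.1 (b1.trans_le d2)
  ext <;> omega

theorem cell_ae_eq (k : ℤ × ℤ) : M.openCell k =ᵐ[volume] M.cell k := by
  rw [← interior_cell]
  exact interior_ae_eq_of_null_frontier ((convex_Icc _ _).addHaar_frontier volume)

variable {M}

namespace Triangulates

variable {Ω : Set (ℝ × ℝ)} (hT : M.Triangulates Ω)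
include hT

theorem isOpen : IsOpen Ω := by
  rw [hT]
  exact isOpen_interior

theorem subset_iUnion : Ω ⊆ ⋃ k ∈ M.cells, M.cell k := by
  nth_rewrite 1 [hT]
  exact interior_subset

theorem openCell_subset {k : ℤ × ℤ} (hk : k ∈ M.cells) : M.openCell k ⊆ Ω := by
  rw [hT]
  exact interior_maximal ((M.openCell_subset_cell k).trans
    (Set.subset_biUnion_of_mem (u := fun k => M.cell k) hk)) (M.isOpen_openCell k)

theorem cell_subset_closure {k : ℤ × ℤ} (hk : k ∈ M.cells) : M.cell k ⊆ closure Ω := by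
  rw [← closure_openCell]
  exact closure_mono (hT.openCell_subset hk)

theorem mem_or_mem_frontier {k : ℤ × ℤ} (hk : k ∈ M.cells) {z : ℝ × ℝ} (hz : z ∈ M.cell k) :
    z ∈ Ω ∨ z ∈ frontier Ω := by
  by_cases h : z ∈ Ω
  · exact Or.inl h
  · exact Or.inr ⟨hT.cell_subset_closure hk hz, by rwa [hT.isOpen.interior_eq]⟩

/-- Points that a mesh cell has in common with a lattice cell outside the mesh lie on `∂Ω`. -/
theorem mem_frontier {k j : ℤ × ℤ} (hk : k ∈ M.cells) (hj : j ∉ M.cells) {z : ℝ × ℝ}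
    (hz : z ∈ M.cell k) (hzj : z ∈ M.cell j) : z ∈ frontier Ω := by
  refine (hT.mem_or_mem_frontier hk hz).resolve_left fun h => hj ?_
  rw [← closure_openCell] at hzj
  obtain ⟨y, hy, hyj⟩ := mem_closure_iff.1 hzj Ω hT.isOpen h
  obtain ⟨i, hi, hyi⟩ := Set.mem_iUnion₂.1 (hT.subset_iUnion hy)
  rwa [M.eq_of_mem_openCell_of_mem_cell hyj hyi]

theorem horizontal_pair_subset {k : ℤ × ℤ} (hk : k ∈ M.cells) (hk' : k + (1, 0) ∈ M.cells) :
    Set.Ioo (M.node₁ k.1) (M.node₁ (k.1 + 1 + 1)) ×ˢ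
      Set.Ioo (M.node₂ k.2) (M.node₂ (k.2 + 1)) ⊆ Ω := by
  nth_rewrite 1 [hT]
  refine interior_maximal ?_ (isOpen_Ioo.prod isOpen_Ioo)
  rintro z ⟨⟨h1, h2⟩, h3, h4⟩
  rcases le_total z.1 (M.node₁ (k.1 + 1)) with h | h
  · refine Set.mem_biUnion hk ?_
    rw [cell_eq]
    exact ⟨⟨h1.le, h⟩, h3.le, h4.le⟩
  · refine Set.mem_biUnion hk' ?_
    rw [cell_eq]
    refine ⟨⟨h, h2.le⟩, ?_⟩
    simpa using ⟨h3.le, h4.le⟩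

theorem vertical_pair_subset {k : ℤ × ℤ} (hk : k ∈ M.cells) (hk' : k + (0, 1) ∈ M.cells) :
    Set.Ioo (M.node₁ k.1) (M.node₁ (k.1 + 1)) ×ˢ
      Set.Ioo (M.node₂ k.2) (M.node₂ (k.2 + 1 + 1)) ⊆ Ω := by
  nth_rewrite 1 [hT]
  refine interior_maximal ?_ (isOpen_Ioo.prod isOpen_Ioo)
  rintro z ⟨⟨h1, h2⟩, h3, h4⟩
  rcases le_total z.2 (M.node₂ (k.2 + 1)) with h | h
  · refine Set.mem_biUnion hk ?_
    rw [cell_eq]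
    exact ⟨⟨h1.le, h2.le⟩, h3.le, h⟩
  · refine Set.mem_biUnion hk' ?_
    rw [cell_eq]
    refine ⟨?_, h, h4.le⟩
    simpa using ⟨h1.le, h2.le⟩

theorem setIntegral_eq_sum {F : ℝ × ℝ → ℝ} (hF : IntegrableOn F Ω) :
    ∫ z in Ω, F z = ∑ k ∈ M.cells, ∫ z in M.openCell k, F z := by
  have hae : (Ω : Set (ℝ × ℝ)) =ᵐ[volume] ⋃ k ∈ M.cells, M.openCell k := by
    have h1 : ∀ᵐ z, ∀ k ∈ M.cells, (z ∈ M.openCell k) = (z ∈ M.cell k) :=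
      (Finset.eventually_all M.cells).2 fun k _ => M.cell_ae_eq k
    filter_upwards [h1] with z hz
    apply propext
    constructor
    · intro h
      obtain ⟨k, hk, hzk⟩ := Set.mem_iUnion₂.1 (hT.subset_iUnion h)
      exact Set.mem_biUnion hk ((hz k hk).mpr hzk)
    · intro h
      obtain ⟨k, hk, hzk⟩ := Set.mem_iUnion₂.1 h
      exact hT.openCell_subset hk hzk
  rw [setIntegral_congr_set hae]
  refine integral_biUnion_finset _ (fun k _ => (M.isOpen_openCell k).measurableSet) ?_
    fun k hk => hF.mono_set (hT.openCell_subset hk)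
  intro j _ k _ hjk
  exact Set.disjoint_left.2 fun z hzj hzk =>
    hjk (M.eq_of_mem_openCell_of_mem_cell hzj (M.openCell_subset_cell k hzk))

end Triangulates

end UniformMesh

/-- Boundary contributions of neighbouring cells cancel: telescoping over a finite set. -/
theorem sum_trace_eq_zero {G : Type*} [AddCommGroup G] [DecidableEq G] (S : Finset G) (e : G)
    {J L R tL tR : G → ℝ} (hJ : ∀ k ∈ S, J k = tR k * R k - tL k * L k)
    (ht : ∀ k ∈ S, k + e ∈ S → tR k = tL (k + e)) (hLR : ∀ k ∈ S, k + e ∈ S → R k = L (k + e))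
    (hR : ∀ k ∈ S, k + e ∉ S → R k = 0) (hL : ∀ k ∈ S, k - e ∉ S → L k = 0) :
    ∑ k ∈ S, J k = 0 := by
  rw [Finset.sum_congr rfl hJ, Finset.sum_sub_distrib, sub_eq_zero]
  have h1 : ∑ k ∈ S, tR k * R k = ∑ k ∈ S with k + e ∈ S, tR k * R k := by
    rw [Finset.sum_filter]
    refine Finset.sum_congr rfl fun k hk => ?_
    split_ifs with h
    · rfl
    · rw [hR k hk h, mul_zero]
  have h2 : ∑ k ∈ S, tL k * L k = ∑ k ∈ S with k - e ∈ S, tL k * L k := by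
    rw [Finset.sum_filter]
    refine Finset.sum_congr rfl fun k hk => ?_
    split_ifs with h
    · rfl
    · rw [hL k hk h, mul_zero]
  rw [h1, h2]
  refine Finset.sum_bij (fun k _ => k + e) ?_ ?_ ?_ ?_
  · intro k hk
    simp only [Finset.mem_filter] at hk ⊢
    simpa using ⟨hk.2, hk.1⟩
  · intro a _ b _ h
    exact add_right_cancel h
  · intro b hb
    simp only [Finset.mem_filter] at hb
    exact ⟨b - e, by simpa using ⟨hb.2, hb.1⟩, by simp⟩
  · intro k hk
    simp only [Finset.mem_filter] at hk
    rw [ht k hk.1 hk.2, hLR k hk.1 hk.2]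

namespace UniformMesh.Triangulates

/-! ### Element-wise integration by parts -/

variable {M : UniformMesh} {Ω : Set (ℝ × ℝ)} {p q : ℝ × ℝ → ℝ} {ψ χ : ℤ × ℤ → ℝ → ℝ}

/-- Element-wise integration by parts in the first variable, for functions that vary continuously
across the vertical edges and vanish on the boundary ones. -/
theorem sum_setIntegral_fst_eq_zero (hT : M.Triangulates Ω) (hp : IntegrableOn p Ω)
    (hq : IntegrableOn q Ω) (h : IsWeakDx Ω p q) (hψ : ∀ k, ContDiff ℝ 1 (ψ k))
    (hχ : ∀ k, Continuous (χ k)) (hχe : ∀ k, χ (k + (1, 0)) = χ k)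
    (hm : ∀ k ∈ M.cells, k + (1, 0) ∈ M.cells →
      ψ k (M.node₁ (k.1 + 1)) = ψ (k + (1, 0)) (M.node₁ (k.1 + 1)))
    (hR : ∀ k ∈ M.cells, k + (1, 0) ∉ M.cells → ψ k (M.node₁ (k.1 + 1)) = 0)
    (hL : ∀ k ∈ M.cells, k - (1, 0) ∉ M.cells → ψ k (M.node₁ k.1) = 0) :
    ∑ k ∈ M.cells, ∫ z in M.openCell k, (p z * deriv (ψ k) z.1 + q z * ψ k z.1) * χ k z.2 = 0 := by
  have hh : (2 * M.h₁) ≠ 0 := by linarith [M.h₁_pos]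
  let l : ℤ × ℤ → ℝ → ℝ := fun k x => (x - M.node₁ k.1) / (2 * M.h₁)
  let r : ℤ × ℤ → ℝ → ℝ := fun k x => (M.node₁ (k.1 + 1) - x) / (2 * M.h₁)
  have hl : ∀ k, ContDiff ℝ 1 (l k) := fun k => (contDiff_id.sub contDiff_const).div_const _
  have hr : ∀ k, ContDiff ℝ 1 (r k) := fun k => (contDiff_const.sub contDiff_id).div_const _
  have l0 : ∀ k, l k (M.node₁ k.1) = 0 := fun k => by simp [l]
  have l1 : ∀ k, l k (M.node₁ (k.1 + 1)) = 1 := fun k => by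
    simp only [l]; rw [M.node₁_add_one, add_sub_cancel_left, div_self hh]
  have r1 : ∀ k, r k (M.node₁ (k.1 + 1)) = 0 := fun k => by simp [r]
  have r0 : ∀ k, r k (M.node₁ k.1) = 1 := fun k => by
    simp only [r]; rw [M.node₁_add_one, add_sub_cancel_left, div_self hh]
  let I : ℤ × ℤ → (ℝ → ℝ) → ℝ := fun k ψ =>
    ∫ z in M.openCell k, (p z * deriv ψ z.1 + q z * ψ z.1) * χ k z.2
  refine sum_trace_eq_zero M.cells (1, 0) (tR := fun k => I k (l k)) (tL := fun k => -I k (r k))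
    (R := fun k => ψ k (M.node₁ (k.1 + 1))) (L := fun k => ψ k (M.node₁ k.1)) ?_ ?_ ?_ hR hL
  · intro k hk
    have hs := hT.openCell_subset hk
    obtain ⟨T, hT'⟩ := exists_trace_fst (M.node₁_lt k.1) (hp.mono_set hs) (hq.mono_set hs)
      (h.mono hs) (hχ k)
    have e : ∀ ψ, ContDiff ℝ 1 ψ → I k ψ = T (M.node₁ (k.1 + 1)) * ψ (M.node₁ (k.1 + 1)) -
        T (M.node₁ k.1) * ψ (M.node₁ k.1) := hT' _ _ le_rfl (M.node₁_lt _).le le_rfl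
    have e3 := e _ (hψ k)
    rw [e _ (hl k), e _ (hr k), l0, l1, r0, r1]
    simp only [I] at e3
    rw [e3]
    ring
  · intro k hk hk'
    have hs := hT.horizontal_pair_subset hk hk'
    have lt1 := M.node₁_lt k.1
    have lt2 := M.node₁_lt (k.1 + 1)
    obtain ⟨T, hT'⟩ := exists_trace_fst (lt1.trans lt2) (hp.mono_set hs) (hq.mono_set hs)
      (h.mono hs) (hχ k)
    have e1 : I k (l k) = T (M.node₁ (k.1 + 1)) * l k (M.node₁ (k.1 + 1)) -
        T (M.node₁ k.1) * l k (M.node₁ k.1) := hT' _ _ le_rfl lt1.le lt2.le _ (hl k)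
    have e2 : I (k + (1, 0)) (r (k + (1, 0))) =
        T (M.node₁ (k.1 + 1 + 1)) * r (k + (1, 0)) (M.node₁ (k.1 + 1 + 1)) -
        T (M.node₁ (k.1 + 1)) * r (k + (1, 0)) (M.node₁ (k.1 + 1)) := by
      have := hT' _ _ lt1.le lt2.le le_rfl _ (hr (k + (1, 0)))
      simp only [I, hχe, openCell, Prod.fst_add, Prod.snd_add, add_zero]
      exact this
    have r0' : r (k + (1, 0)) (M.node₁ (k.1 + 1)) = 1 := r0 (k + (1, 0))
    have r1' : r (k + (1, 0)) (M.node₁ (k.1 + 1 + 1)) = 0 := r1 (k + (1, 0))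
    rw [e1, e2, l0, l1, r0', r1']
    ring
  · intro k hk hk'
    exact hm k hk hk'

/-- Element-wise integration by parts in the second variable, for functions that vary continuously
across the horizontal edges and vanish on the boundary ones. -/
theorem sum_setIntegral_snd_eq_zero (hT : M.Triangulates Ω) (hp : IntegrableOn p Ω)
    (hq : IntegrableOn q Ω) (h : IsWeakDy Ω p q) (hψ : ∀ k, ContDiff ℝ 1 (ψ k))
    (hχ : ∀ k, Continuous (χ k)) (hχe : ∀ k, χ (k + (0, 1)) = χ k)
    (hm : ∀ k ∈ M.cells, k + (0, 1) ∈ M.cells →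
      ψ k (M.node₂ (k.2 + 1)) = ψ (k + (0, 1)) (M.node₂ (k.2 + 1)))
    (hR : ∀ k ∈ M.cells, k + (0, 1) ∉ M.cells → ψ k (M.node₂ (k.2 + 1)) = 0)
    (hL : ∀ k ∈ M.cells, k - (0, 1) ∉ M.cells → ψ k (M.node₂ k.2) = 0) :
    ∑ k ∈ M.cells, ∫ z in M.openCell k, (p z * deriv (ψ k) z.2 + q z * ψ k z.2) * χ k z.1 = 0 := by
  have hh : (2 * M.h₂) ≠ 0 := by linarith [M.h₂_pos]
  let l : ℤ × ℤ → ℝ → ℝ := fun k x => (x - M.node₂ k.2) / (2 * M.h₂)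
  let r : ℤ × ℤ → ℝ → ℝ := fun k x => (M.node₂ (k.2 + 1) - x) / (2 * M.h₂)
  have hl : ∀ k, ContDiff ℝ 1 (l k) := fun k => (contDiff_id.sub contDiff_const).div_const _
  have hr : ∀ k, ContDiff ℝ 1 (r k) := fun k => (contDiff_const.sub contDiff_id).div_const _
  have l0 : ∀ k, l k (M.node₂ k.2) = 0 := fun k => by simp [l]
  have l1 : ∀ k, l k (M.node₂ (k.2 + 1)) = 1 := fun k => by
    simp only [l]; rw [M.node₂_add_one, add_sub_cancel_left, div_self hh]
  have r1 : ∀ k, r k (M.node₂ (k.2 + 1)) = 0 := fun k => by simp [r]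
  have r0 : ∀ k, r k (M.node₂ k.2) = 1 := fun k => by
    simp only [r]; rw [M.node₂_add_one, add_sub_cancel_left, div_self hh]
  let I : ℤ × ℤ → (ℝ → ℝ) → ℝ := fun k ψ =>
    ∫ z in M.openCell k, (p z * deriv ψ z.2 + q z * ψ z.2) * χ k z.1
  refine sum_trace_eq_zero M.cells (0, 1) (tR := fun k => I k (l k)) (tL := fun k => -I k (r k))
    (R := fun k => ψ k (M.node₂ (k.2 + 1))) (L := fun k => ψ k (M.node₂ k.2)) ?_ ?_ ?_ hR hL
  · intro k hk
    have hs := hT.openCell_subset hk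
    obtain ⟨T, hT'⟩ := exists_trace_snd (M.node₂_lt k.2) (hp.mono_set hs) (hq.mono_set hs)
      (h.mono hs) (hχ k)
    have e : ∀ ψ, ContDiff ℝ 1 ψ → I k ψ = T (M.node₂ (k.2 + 1)) * ψ (M.node₂ (k.2 + 1)) -
        T (M.node₂ k.2) * ψ (M.node₂ k.2) := hT' _ _ le_rfl (M.node₂_lt _).le le_rfl
    have e3 := e _ (hψ k)
    rw [e _ (hl k), e _ (hr k), l0, l1, r0, r1]
    simp only [I] at e3
    rw [e3]
    ring
  · intro k hk hk'
    have hs := hT.vertical_pair_subset hk hk'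
    have lt1 := M.node₂_lt k.2
    have lt2 := M.node₂_lt (k.2 + 1)
    obtain ⟨T, hT'⟩ := exists_trace_snd (lt1.trans lt2) (hp.mono_set hs) (hq.mono_set hs)
      (h.mono hs) (hχ k)
    have e1 : I k (l k) = T (M.node₂ (k.2 + 1)) * l k (M.node₂ (k.2 + 1)) -
        T (M.node₂ k.2) * l k (M.node₂ k.2) := hT' _ _ le_rfl lt1.le lt2.le _ (hl k)
    have e2 : I (k + (0, 1)) (r (k + (0, 1))) =
        T (M.node₂ (k.2 + 1 + 1)) * r (k + (0, 1)) (M.node₂ (k.2 + 1 + 1)) -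
        T (M.node₂ (k.2 + 1)) * r (k + (0, 1)) (M.node₂ (k.2 + 1)) := by
      have := hT' _ _ lt1.le lt2.le le_rfl _ (hr (k + (0, 1)))
      simp only [I, hχe, openCell, Prod.fst_add, Prod.snd_add, add_zero]
      exact this
    have r0' : r (k + (0, 1)) (M.node₂ (k.2 + 1)) = 1 := r0 (k + (0, 1))
    have r1' : r (k + (0, 1)) (M.node₂ (k.2 + 1 + 1)) = 0 := r1 (k + (0, 1))
    rw [e1, e2, l0, l1, r0', r1']
    ring
  · intro k hk hk'
    exact hm k hk hk'

end UniformMesh.Triangulates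

/-! ### Shape functions in local coordinates -/

/-- The shape functions of the rectangular Morley element in local coordinates. -/
def morleyPoly (a : Fin 8 → ℝ) (x y : ℝ) : ℝ :=
  a 0 + a 1 * x + a 2 * x ^ 2 + a 3 * x ^ 3 + a 4 * y + a 5 * y ^ 2 + a 6 * y ^ 3 + a 7 * (x * y)

/-- The shape function with coefficients `a` in local coordinates with origin `c`. -/
def localPoly (c : ℝ × ℝ) (a : Fin 8 → ℝ) (z : ℝ × ℝ) : ℝ := morleyPoly a (z.1 - c.1) (z.2 - c.2)

theorem exists_eq_localPoly (c : ℝ × ℝ) {p : ℝ × ℝ → ℝ} (hp : p ∈ shapeSpace) :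
    ∃ a, p = localPoly c a := by
  let L : (Fin 8 → ℝ) →ₗ[ℝ] (ℝ × ℝ → ℝ) :=
    { toFun := localPoly c
      map_add' := fun a b => by
        funext z
        simp only [localPoly, morleyPoly, Pi.add_apply]
        ring
      map_smul' := fun t a => by
        funext z
        simp only [localPoly, morleyPoly, Pi.smul_apply, smul_eq_mul, RingHom.id_apply]
        ring }
  have hle : shapeSpace ≤ LinearMap.range L := by
    refine sup_le (Submodule.span_le.2 ?_) (Submodule.span_le.2 ?_)
    · rintro q ⟨i, j, hij, rfl⟩
      have hi : i ≤ 2 := by omega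
      have hj : j ≤ 2 - i := by omega
      interval_cases i <;> interval_cases j
      · refine ⟨![1, 0, 0, 0, 0, 0, 0, 0], funext fun z => ?_⟩
        simp [L, localPoly, morleyPoly]
      · refine ⟨![c.2, 0, 0, 0, 1, 0, 0, 0], funext fun z => ?_⟩
        simp [L, localPoly, morleyPoly]
      · refine ⟨![c.2 ^ 2, 0, 0, 0, 2 * c.2, 1, 0, 0], funext fun z => ?_⟩
        simp [L, localPoly, morleyPoly]
        ring
      · refine ⟨![c.1, 1, 0, 0, 0, 0, 0, 0], funext fun z => ?_⟩
        simp [L, localPoly, morleyPoly]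
      · refine ⟨![c.1 * c.2, c.2, 0, 0, c.1, 0, 0, 1], funext fun z => ?_⟩
        simp [L, localPoly, morleyPoly]
        ring
      · refine ⟨![c.1 ^ 2, 2 * c.1, 1, 0, 0, 0, 0, 0], funext fun z => ?_⟩
        simp [L, localPoly, morleyPoly]
        ring
    · rintro q (rfl | rfl)
      · refine ⟨![c.1 ^ 3, 3 * c.1 ^ 2, 3 * c.1, 1, 0, 0, 0, 0], funext fun z => ?_⟩
        simp [L, localPoly, morleyPoly]
        ring
      · refine ⟨![c.2 ^ 3, 0, 0, 0, 3 * c.2 ^ 2, 3 * c.2, 1, 0], funext fun z => ?_⟩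
        simp [L, localPoly, morleyPoly]
        ring
  obtain ⟨a, ha⟩ := hle hp
  exact ⟨a, ha.symm⟩

theorem contDiff_localPoly (c : ℝ × ℝ) (a : Fin 8 → ℝ) : ContDiff ℝ ∞ (localPoly c a) := by
  unfold localPoly morleyPoly
  fun_prop

theorem pdx_eq_of_hasDerivAt {v : ℝ × ℝ → ℝ} (hv : Differentiable ℝ v) {z : ℝ × ℝ} {d : ℝ}
    (h : HasDerivAt (fun x => v (x, z.2)) d z.1) : pdx v z = d := by
  have h1 : HasDerivAt (fun x : ℝ => (x, z.2)) ((1 : ℝ), (0 : ℝ)) z.1 :=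
    (hasDerivAt_id z.1).prodMk (hasDerivAt_const _ _)
  exact ((hv z).hasFDerivAt.comp_hasDerivAt z.1 h1).unique h

theorem pdy_eq_of_hasDerivAt {v : ℝ × ℝ → ℝ} (hv : Differentiable ℝ v) {z : ℝ × ℝ} {d : ℝ}
    (h : HasDerivAt (fun y => v (z.1, y)) d z.2) : pdy v z = d := by
  have h1 : HasDerivAt (fun y : ℝ => (z.1, y)) ((0 : ℝ), (1 : ℝ)) z.2 :=
    (hasDerivAt_const _ _).prodMk (hasDerivAt_id z.2)
  exact ((hv z).hasFDerivAt.comp_hasDerivAt z.2 h1).unique h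

theorem hasDerivAt_cubic (b₀ b₁ b₂ b₃ c x : ℝ) :
    HasDerivAt (fun x => b₀ + b₁ * (x - c) + b₂ * (x - c) ^ 2 + b₃ * (x - c) ^ 3)
      (b₁ + 2 * b₂ * (x - c) + 3 * b₃ * (x - c) ^ 2) x := by
  have h := (hasDerivAt_id' x).sub_const c
  convert! (((h.const_mul b₁).const_add b₀).add ((h.pow 2).const_mul b₂)).add
    ((h.pow 3).const_mul b₃) using 1
  simp
  ring

theorem pdx_localPoly (c : ℝ × ℝ) (a : Fin 8 → ℝ) (z : ℝ × ℝ) :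
    pdx (localPoly c a) z = a 1 + 2 * a 2 * (z.1 - c.1) + 3 * a 3 * (z.1 - c.1) ^ 2 +
      a 7 * (z.2 - c.2) := by
  refine pdx_eq_of_hasDerivAt ((contDiff_localPoly c a).differentiable (by simp)) ?_
  convert! hasDerivAt_cubic (a 0 + a 4 * (z.2 - c.2) + a 5 * (z.2 - c.2) ^ 2 +
    a 6 * (z.2 - c.2) ^ 3) (a 1 + a 7 * (z.2 - c.2)) (a 2) (a 3) c.1 z.1 using 1
  · funext x
    simp only [localPoly, morleyPoly]
    ring
  · ring

theorem pdy_localPoly (c : ℝ × ℝ) (a : Fin 8 → ℝ) (z : ℝ × ℝ) :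
    pdy (localPoly c a) z = a 4 + 2 * a 5 * (z.2 - c.2) + 3 * a 6 * (z.2 - c.2) ^ 2 +
      a 7 * (z.1 - c.1) := by
  refine pdy_eq_of_hasDerivAt ((contDiff_localPoly c a).differentiable (by simp)) ?_
  convert! hasDerivAt_cubic (a 0 + a 1 * (z.1 - c.1) + a 2 * (z.1 - c.1) ^ 2 +
    a 3 * (z.1 - c.1) ^ 3) (a 4 + a 7 * (z.1 - c.1)) (a 5) (a 6) c.2 z.2 using 1
  · funext x
    simp only [localPoly, morleyPoly]
    ring
  · ring

theorem partialDeriv_localPoly_xx (c : ℝ × ℝ) (a : Fin 8 → ℝ) (z : ℝ × ℝ) :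
    partialDeriv (2, 0) (localPoly c a) z = 2 * a 2 + 6 * a 3 * (z.1 - c.1) := by
  refine pdx_eq_of_hasDerivAt ((contDiff_pdx (contDiff_localPoly c a)).differentiable (by simp)) ?_
  simp only [pdx_localPoly]
  convert! hasDerivAt_cubic (a 1 + a 7 * (z.2 - c.2)) (2 * a 2) (3 * a 3) 0 c.1 z.1 using 1
  · funext x
    ring
  · ring

theorem partialDeriv_localPoly_xy (c : ℝ × ℝ) (a : Fin 8 → ℝ) (z : ℝ × ℝ) :
    partialDeriv (1, 1) (localPoly c a) z = a 7 := by
  refine pdx_eq_of_hasDerivAt ((contDiff_pdy (contDiff_localPoly c a)).differentiable (by simp)) ?_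
  simp only [pdy_localPoly]
  convert! hasDerivAt_cubic (a 4 + 2 * a 5 * (z.2 - c.2) + 3 * a 6 * (z.2 - c.2) ^ 2) (a 7) 0 0
    c.1 z.1 using 1
  · funext x
    ring
  · ring

theorem partialDeriv_localPoly_yy (c : ℝ × ℝ) (a : Fin 8 → ℝ) (z : ℝ × ℝ) :
    partialDeriv (0, 2) (localPoly c a) z = 2 * a 5 + 6 * a 6 * (z.2 - c.2) := by
  refine pdy_eq_of_hasDerivAt ((contDiff_pdy (contDiff_localPoly c a)).differentiable (by simp)) ?_
  simp only [pdy_localPoly]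
  convert! hasDerivAt_cubic (a 4 + a 7 * (z.1 - c.1)) (2 * a 5) (3 * a 6) 0 c.2 z.2 using 1
  · funext x
    ring
  · ring

/-- Integral of an affine function over an interval with midpoint `c`. -/
theorem integral_affine_symm (b₀ b₁ c h : ℝ) :
    ∫ s in (c - h)..(c + h), (b₀ + b₁ * (s - c)) = 2 * h * b₀ := by
  have hd : ∀ s ∈ Set.uIcc (c - h) (c + h),
      HasDerivAt (fun s => 0 + b₀ * (s - c) + b₁ / 2 * (s - c) ^ 2 + 0 * (s - c) ^ 3)
        (b₀ + b₁ * (s - c)) s := fun s _ => by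
    convert! hasDerivAt_cubic 0 b₀ (b₁ / 2) 0 c s using 1
    ring
  rw [intervalIntegral.integral_eq_sub_of_hasDerivAt hd
    ((by fun_prop : Continuous fun s : ℝ => b₀ + b₁ * (s - c)).intervalIntegrable _ _)]
  ring

namespace UniformMesh

variable (M : UniformMesh)

/-- The midpoint of the cell with lower left corner `vertex k`. -/
def center (k : ℤ × ℤ) : ℝ × ℝ := (M.node₁ k.1 + M.h₁, M.node₂ k.2 + M.h₂)

/-- The degrees of freedom of neighbouring local polynomials agree, and those on the boundary
vanish. -/
structure IsMatched (a : ℤ × ℤ → Fin 8 → ℝ) : Prop where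
  val_fst : ∀ k ∈ M.cells, k + (1, 0) ∈ M.cells → ∀ s, s = M.h₂ ∨ s = -M.h₂ →
    morleyPoly (a k) M.h₁ s = morleyPoly (a (k + (1, 0))) (-M.h₁) s
  val_right : ∀ k ∈ M.cells, k + (1, 0) ∉ M.cells → ∀ s, s = M.h₂ ∨ s = -M.h₂ →
    morleyPoly (a k) M.h₁ s = 0
  val_left : ∀ k ∈ M.cells, k - (1, 0) ∉ M.cells → ∀ s, s = M.h₂ ∨ s = -M.h₂ →
    morleyPoly (a k) (-M.h₁) s = 0
  val_snd : ∀ k ∈ M.cells, k + (0, 1) ∈ M.cells → ∀ s, s = M.h₁ ∨ s = -M.h₁ →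
    morleyPoly (a k) s M.h₂ = morleyPoly (a (k + (0, 1))) s (-M.h₂)
  val_top : ∀ k ∈ M.cells, k + (0, 1) ∉ M.cells → ∀ s, s = M.h₁ ∨ s = -M.h₁ →
    morleyPoly (a k) s M.h₂ = 0
  val_bottom : ∀ k ∈ M.cells, k - (0, 1) ∉ M.cells → ∀ s, s = M.h₁ ∨ s = -M.h₁ →
    morleyPoly (a k) s (-M.h₂) = 0
  slope_fst : ∀ k ∈ M.cells, k + (1, 0) ∈ M.cells →
    a k 1 + 2 * a k 2 * M.h₁ + 3 * a k 3 * M.h₁ ^ 2 =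
      a (k + (1, 0)) 1 + 2 * a (k + (1, 0)) 2 * -M.h₁ + 3 * a (k + (1, 0)) 3 * (-M.h₁) ^ 2
  slope_right : ∀ k ∈ M.cells, k + (1, 0) ∉ M.cells →
    a k 1 + 2 * a k 2 * M.h₁ + 3 * a k 3 * M.h₁ ^ 2 = 0
  slope_left : ∀ k ∈ M.cells, k - (1, 0) ∉ M.cells →
    a k 1 + 2 * a k 2 * -M.h₁ + 3 * a k 3 * (-M.h₁) ^ 2 = 0
  slope_snd : ∀ k ∈ M.cells, k + (0, 1) ∈ M.cells →
    a k 4 + 2 * a k 5 * M.h₂ + 3 * a k 6 * M.h₂ ^ 2 =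
      a (k + (0, 1)) 4 + 2 * a (k + (0, 1)) 5 * -M.h₂ + 3 * a (k + (0, 1)) 6 * (-M.h₂) ^ 2
  slope_top : ∀ k ∈ M.cells, k + (0, 1) ∉ M.cells →
    a k 4 + 2 * a k 5 * M.h₂ + 3 * a k 6 * M.h₂ ^ 2 = 0
  slope_bottom : ∀ k ∈ M.cells, k - (0, 1) ∉ M.cells →
    a k 4 + 2 * a k 5 * -M.h₂ + 3 * a k 6 * (-M.h₂) ^ 2 = 0

theorem vertex_mono {m n : ℤ × ℤ} (h : m ≤ n) : M.vertex m ≤ M.vertex n :=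
  ⟨M.node₁_strictMono.monotone h.1, M.node₂_strictMono.monotone h.2⟩

theorem vertex_mem_cell {m k : ℤ × ℤ} (h : k ≤ m) (h' : m ≤ k + (1, 1)) :
    M.vertex m ∈ M.cell k := ⟨M.vertex_mono h, M.vertex_mono h'⟩

theorem vEdge_subset_cell {m k : ℤ × ℤ} (h : k ≤ m) (h' : m + (0, 1) ≤ k + (1, 1)) :
    M.vEdge m ⊆ M.cell k := Set.Icc_subset_Icc (M.vertex_mono h) (M.vertex_mono h')

theorem hEdge_subset_cell {m k : ℤ × ℤ} (h : k ≤ m) (h' : m + (1, 0) ≤ k + (1, 1)) :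
    M.hEdge m ⊆ M.cell k := Set.Icc_subset_Icc (M.vertex_mono h) (M.vertex_mono h')

theorem vFlux_localPoly_left (k : ℤ × ℤ) (a : Fin 8 → ℝ) :
    M.vFlux k (localPoly (M.center k) a) =
      2 * M.h₂ * (a 1 + 2 * a 2 * -M.h₁ + 3 * a 3 * (-M.h₁) ^ 2) := by
  rw [← integral_affine_symm _ (a 7) (M.center k).2]
  simp only [vFlux, pdx_localPoly, vertex_eq, Prod.snd_add, node₂_add_one, center]
  congr 1
  · funext s
    ring
  · ring
  · ring

theorem vFlux_localPoly_right (k : ℤ × ℤ) (a : Fin 8 → ℝ) :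
    M.vFlux (k + (1, 0)) (localPoly (M.center k) a) =
      2 * M.h₂ * (a 1 + 2 * a 2 * M.h₁ + 3 * a 3 * M.h₁ ^ 2) := by
  rw [← integral_affine_symm _ (a 7) (M.center k).2]
  simp only [vFlux, pdx_localPoly, vertex_eq, Prod.snd_add, Prod.fst_add, node₂_add_one,
    node₁_add_one, center, add_zero]
  congr 1
  · funext s
    ring
  · ring
  · ring

theorem hFlux_localPoly_bottom (k : ℤ × ℤ) (a : Fin 8 → ℝ) :
    M.hFlux k (localPoly (M.center k) a) =
      2 * M.h₁ * (a 4 + 2 * a 5 * -M.h₂ + 3 * a 6 * (-M.h₂) ^ 2) := by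
  rw [← integral_affine_symm _ (a 7) (M.center k).1]
  simp only [hFlux, pdy_localPoly, vertex_eq, Prod.fst_add, node₁_add_one, center]
  congr 1
  · funext s
    ring
  · ring
  · ring

theorem hFlux_localPoly_top (k : ℤ × ℤ) (a : Fin 8 → ℝ) :
    M.hFlux (k + (0, 1)) (localPoly (M.center k) a) =
      2 * M.h₁ * (a 4 + 2 * a 5 * M.h₂ + 3 * a 6 * M.h₂ ^ 2) := by
  rw [← integral_affine_symm _ (a 7) (M.center k).1]
  simp only [hFlux, pdy_localPoly, vertex_eq, Prod.snd_add, Prod.fst_add, node₂_add_one,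
    node₁_add_one, center, add_zero]
  congr 1
  · funext s
    ring
  · ring
  · ring

theorem localPoly_vertex (k : ℤ × ℤ) (a : Fin 8 → ℝ) :
    localPoly (M.center k) a (M.vertex k) = morleyPoly a (-M.h₁) (-M.h₂) := by
  simp [localPoly, vertex_eq, center]

theorem localPoly_vertex_right (k : ℤ × ℤ) (a : Fin 8 → ℝ) :
    localPoly (M.center k) a (M.vertex (k + (1, 0))) = morleyPoly a M.h₁ (-M.h₂) := by
  simp only [localPoly, vertex_eq, center, Prod.fst_add, Prod.snd_add, node₁_add_one, add_zero]
  congr 1 <;> ring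

theorem localPoly_vertex_top (k : ℤ × ℤ) (a : Fin 8 → ℝ) :
    localPoly (M.center k) a (M.vertex (k + (0, 1))) = morleyPoly a (-M.h₁) M.h₂ := by
  simp only [localPoly, vertex_eq, center, Prod.fst_add, Prod.snd_add, node₂_add_one, add_zero]
  congr 1 <;> ring

theorem localPoly_vertex_top_right (k : ℤ × ℤ) (a : Fin 8 → ℝ) :
    localPoly (M.center k) a (M.vertex (k + (1, 1))) = morleyPoly a M.h₁ M.h₂ := by
  simp only [localPoly, vertex_eq, center, Prod.fst_add, Prod.snd_add, node₁_add_one,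
    node₂_add_one]
  congr 1 <;> ring

variable {M}

namespace IsMorleyFamily

variable {Ω : Set (ℝ × ℝ)} {p : ℤ × ℤ → ℝ × ℝ → ℝ}

theorem vertex_eq (hp : M.IsMorleyFamily Ω p) (hT : M.Triangulates Ω) {m k k' : ℤ × ℤ}
    (hk : k ∈ M.cells) (hk' : k' ∈ M.cells) (h1 : k ≤ m) (h2 : m ≤ k + (1, 1)) (h3 : k' ≤ m)
    (h4 : m ≤ k' + (1, 1)) : p k (M.vertex m) = p k' (M.vertex m) := by
  have hm := M.vertex_mem_cell h1 h2
  have hm' := M.vertex_mem_cell h3 h4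
  rcases hT.mem_or_mem_frontier hk hm with h | h
  · exact hp.vertex_internal m k hk k' hk' h hm hm'
  · rw [hp.vertex_boundary m k hk h hm, hp.vertex_boundary m k' hk' h hm']

theorem vertex_eq_zero (hp : M.IsMorleyFamily Ω p) (hT : M.Triangulates Ω) {m k k' : ℤ × ℤ}
    (hk : k ∈ M.cells) (hk' : k' ∉ M.cells) (h1 : k ≤ m) (h2 : m ≤ k + (1, 1)) (h3 : k' ≤ m)
    (h4 : m ≤ k' + (1, 1)) : p k (M.vertex m) = 0 :=
  hp.vertex_boundary m k hk
    (hT.mem_frontier hk hk' (M.vertex_mem_cell h1 h2) (M.vertex_mem_cell h3 h4))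
    (M.vertex_mem_cell h1 h2)

theorem vFlux_eq_zero (hp : M.IsMorleyFamily Ω p) (hT : M.Triangulates Ω) {m k k' : ℤ × ℤ}
    (hk : k ∈ M.cells) (hk' : k' ∉ M.cells) (h1 : k ≤ m) (h2 : m + (0, 1) ≤ k + (1, 1))
    (h3 : k' ≤ m) (h4 : m + (0, 1) ≤ k' + (1, 1)) : M.vFlux m (p k) = 0 :=
  hp.vEdge_boundary m k hk (fun _ hz => hT.mem_frontier hk hk' (M.vEdge_subset_cell h1 h2 hz)
    (M.vEdge_subset_cell h3 h4 hz)) (M.vEdge_subset_cell h1 h2)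

theorem hFlux_eq_zero (hp : M.IsMorleyFamily Ω p) (hT : M.Triangulates Ω) {m k k' : ℤ × ℤ}
    (hk : k ∈ M.cells) (hk' : k' ∉ M.cells) (h1 : k ≤ m) (h2 : m + (1, 0) ≤ k + (1, 1))
    (h3 : k' ≤ m) (h4 : m + (1, 0) ≤ k' + (1, 1)) : M.hFlux m (p k) = 0 :=
  hp.hEdge_boundary m k hk (fun _ hz => hT.mem_frontier hk hk' (M.hEdge_subset_cell h1 h2 hz)
    (M.hEdge_subset_cell h3 h4 hz)) (M.hEdge_subset_cell h1 h2)

theorem isMatched (hp : M.IsMorleyFamily Ω p) (hT : M.Triangulates Ω) {a : ℤ × ℤ → Fin 8 → ℝ}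
    (ha : ∀ k ∈ M.cells, p k = localPoly (M.center k) (a k)) : M.IsMatched a := by
  have c1 : 2 * M.h₁ ≠ 0 := by linarith [M.h₁_pos]
  have c2 : 2 * M.h₂ ≠ 0 := by linarith [M.h₂_pos]
  have e11 : ((1, 1) : ℤ × ℤ) = (1, 0) + (0, 1) := rfl
  have e11' : ((1, 1) : ℤ × ℤ) = (0, 1) + (1, 0) := rfl
  have p10 : (0 : ℤ × ℤ) ≤ (1, 0) := ⟨by simp, by simp⟩
  have p01 : (0 : ℤ × ℤ) ≤ (0, 1) := ⟨by simp, by simp⟩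
  have p11 : (0 : ℤ × ℤ) ≤ (1, 1) := ⟨by simp, by simp⟩
  have q10 : ((1, 0) : ℤ × ℤ) ≤ (1, 1) := ⟨by simp, by simp⟩
  have q01 : ((0, 1) : ℤ × ℤ) ≤ (1, 1) := ⟨by simp, by simp⟩
  have a10 : ∀ k : ℤ × ℤ, k ≤ k + (1, 0) := fun k => le_add_of_nonneg_right p10
  have a01 : ∀ k : ℤ × ℤ, k ≤ k + (0, 1) := fun k => le_add_of_nonneg_right p01
  have a11 : ∀ k : ℤ × ℤ, k ≤ k + (1, 1) := fun k => le_add_of_nonneg_right p11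
  have b10 : ∀ k : ℤ × ℤ, k + (1, 0) ≤ k + (1, 1) := fun k => add_le_add le_rfl q10
  have b01 : ∀ k : ℤ × ℤ, k + (0, 1) ≤ k + (1, 1) := fun k => add_le_add le_rfl q01
  have s10 : ∀ k : ℤ × ℤ, k - (1, 0) ≤ k := fun k => sub_le_self _ p10
  have s01 : ∀ k : ℤ × ℤ, k - (0, 1) ≤ k := fun k => sub_le_self _ p01
  have t10 : ∀ k : ℤ × ℤ, k - (1, 0) + (1, 1) = k + (0, 1) := fun k => by rw [e11]; abel
  have t01 : ∀ k : ℤ × ℤ, k - (0, 1) + (1, 1) = k + (1, 0) := fun k => by rw [e11]; abel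
  have r10 : ∀ k : ℤ × ℤ, k + (1, 0) + (0, 1) = k + (1, 1) := fun k => by rw [e11]; abel
  have r01 : ∀ k : ℤ × ℤ, k + (0, 1) + (1, 0) = k + (1, 1) := fun k => by rw [e11]; abel
  constructor
  · rintro k hk hk' s (rfl | rfl)
    · have h := hp.vertex_eq hT (m := k + (1, 1)) hk hk' (a11 k) le_rfl (b10 k)
        (by rw [← r10]; exact b01 _)
      rw [ha k hk, ha _ hk', localPoly_vertex_top_right, ← r10, localPoly_vertex_top] at h
      exact h
    · have h := hp.vertex_eq hT (m := k + (1, 0)) hk hk' (a10 k) (b10 k) le_rfl (a11 _)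
      rw [ha k hk, ha _ hk', localPoly_vertex_right, localPoly_vertex] at h
      exact h
  · rintro k hk hk' s (rfl | rfl)
    · have h := hp.vertex_eq_zero hT (m := k + (1, 1)) hk hk' (a11 k) le_rfl (b10 k)
        (by rw [← r10]; exact b01 _)
      rw [ha k hk, localPoly_vertex_top_right] at h
      exact h
    · have h := hp.vertex_eq_zero hT (m := k + (1, 0)) hk hk' (a10 k) (b10 k) le_rfl (a11 _)
      rw [ha k hk, localPoly_vertex_right] at h
      exact h
  · rintro k hk hk' s (rfl | rfl)
    · have h := hp.vertex_eq_zero hT (m := k + (0, 1)) hk hk' (a01 k) (b01 k)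
        ((s10 k).trans (a01 k)) (t10 k).ge
      rw [ha k hk, localPoly_vertex_top] at h
      exact h
    · have h := hp.vertex_eq_zero hT (m := k) hk hk' le_rfl (a11 k) (s10 k)
        ((a01 k).trans (t10 k).ge)
      rw [ha k hk, localPoly_vertex] at h
      exact h
  · rintro k hk hk' s (rfl | rfl)
    · have h := hp.vertex_eq hT (m := k + (1, 1)) hk hk' (a11 k) le_rfl (b01 k)
        (by rw [← r01]; exact b10 _)
      rw [ha k hk, ha _ hk', localPoly_vertex_top_right, ← r01, localPoly_vertex_right] at h
      exact h
    · have h := hp.vertex_eq hT (m := k + (0, 1)) hk hk' (a01 k) (b01 k) le_rfl (a11 _)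
      rw [ha k hk, ha _ hk', localPoly_vertex_top, localPoly_vertex] at h
      exact h
  · rintro k hk hk' s (rfl | rfl)
    · have h := hp.vertex_eq_zero hT (m := k + (1, 1)) hk hk' (a11 k) le_rfl (b01 k)
        (by rw [← r01]; exact b10 _)
      rw [ha k hk, localPoly_vertex_top_right] at h
      exact h
    · have h := hp.vertex_eq_zero hT (m := k + (0, 1)) hk hk' (a01 k) (b01 k) le_rfl (a11 _)
      rw [ha k hk, localPoly_vertex_top] at h
      exact h
  · rintro k hk hk' s (rfl | rfl)
    · have h := hp.vertex_eq_zero hT (m := k + (1, 0)) hk hk' (a10 k) (b10 k)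
        ((s01 k).trans (a10 k)) (t01 k).ge
      rw [ha k hk, localPoly_vertex_right] at h
      exact h
    · have h := hp.vertex_eq_zero hT (m := k) hk hk' le_rfl (a11 k) (s01 k)
        ((a10 k).trans (t01 k).ge)
      rw [ha k hk, localPoly_vertex] at h
      exact h
  · intro k hk hk'
    have h := hp.vEdge_internal (k + (1, 0)) k hk _ hk' (M.vEdge_subset_cell (a10 k) (r10 k).le)
      (M.vEdge_subset_cell le_rfl (b01 _))
    rw [ha k hk, ha _ hk', vFlux_localPoly_right, vFlux_localPoly_left] at h
    exact mul_left_cancel₀ c2 h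
  · intro k hk hk'
    have h := hp.vFlux_eq_zero hT (m := k + (1, 0)) hk hk' (a10 k) (r10 k).le le_rfl (b01 _)
    rw [ha k hk, vFlux_localPoly_right] at h
    exact (mul_eq_zero.1 h).resolve_left c2
  · intro k hk hk'
    have h := hp.vFlux_eq_zero hT (m := k) hk hk' le_rfl (b01 k) (s10 k) (t10 k).ge
    rw [ha k hk, vFlux_localPoly_left] at h
    exact (mul_eq_zero.1 h).resolve_left c2
  · intro k hk hk'
    have h := hp.hEdge_internal (k + (0, 1)) k hk _ hk' (M.hEdge_subset_cell (a01 k) (r01 k).le)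
      (M.hEdge_subset_cell le_rfl (b10 _))
    rw [ha k hk, ha _ hk', hFlux_localPoly_top, hFlux_localPoly_bottom] at h
    exact mul_left_cancel₀ c1 h
  · intro k hk hk'
    have h := hp.hFlux_eq_zero hT (m := k + (0, 1)) hk hk' (a01 k) (r01 k).le le_rfl (b10 _)
    rw [ha k hk, hFlux_localPoly_top] at h
    exact (mul_eq_zero.1 h).resolve_left c1
  · intro k hk hk'
    have h := hp.hFlux_eq_zero hT (m := k) hk hk' le_rfl (b10 k) (s01 k) (t01 k).ge
    rw [ha k hk, hFlux_localPoly_bottom] at h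
    exact (mul_eq_zero.1 h).resolve_left c1

end IsMorleyFamily

end UniformMesh

namespace UniformMesh

/-! ### The consistency error as a sum of interior integrals -/

variable {M : UniformMesh} {Ω : Set (ℝ × ℝ)} {p q : ℝ × ℝ → ℝ}

theorem integrableOn_openCell_mul (hp : IntegrableOn p Ω) {k : ℤ × ℤ} (hk : M.openCell k ⊆ Ω)
    {g : ℝ × ℝ → ℝ} (hg : Continuous g) : IntegrableOn (fun z => p z * g z) (M.openCell k) :=
  (hp.mono_set hk).mul_continuousOn_of_subset hg.continuousOn (M.isOpen_openCell k).measurableSet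
    (K := M.cell k) isCompact_Icc (M.openCell_subset_cell k)

variable (M) in
/-- Families of functions on the cells whose integrals add up to zero. -/
structure IsNull (F : ℤ × ℤ → ℝ × ℝ → ℝ) : Prop where
  integrableOn : ∀ k ∈ M.cells, IntegrableOn (F k) (M.openCell k)
  sum_eq_zero : ∑ k ∈ M.cells, ∫ z in M.openCell k, F k z = 0

namespace IsNull

variable {F G : ℤ × ℤ → ℝ × ℝ → ℝ}

theorem add (hF : M.IsNull F) (hG : M.IsNull G) : M.IsNull (fun k z => F k z + G k z) := by
  refine ⟨fun k hk => (hF.1 k hk).add (hG.1 k hk), ?_⟩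
  rw [Finset.sum_congr rfl fun k hk => integral_add (hF.1 k hk) (hG.1 k hk),
    Finset.sum_add_distrib, hF.2, hG.2, add_zero]

theorem const_mul (hF : M.IsNull F) (c : ℝ) : M.IsNull (fun k z => c * F k z) := by
  refine ⟨fun k hk => (hF.1 k hk).const_mul c, ?_⟩
  simp only [integral_const_mul, ← Finset.mul_sum, hF.2, mul_zero]

theorem congr (hF : M.IsNull F) (h : ∀ k z, F k z = G k z) : M.IsNull G := by
  have : F = G := funext fun k => funext (h k)
  rwa [← this]

end IsNull

/-- Cubic polynomials in the first local coordinate whose values match across vertical edges. -/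
theorem Triangulates.isNull_fst (hT : M.Triangulates Ω) (hp : IntegrableOn p Ω)
    (hq : IntegrableOn q Ω) (h : IsWeakDx Ω p q) {κ : ℝ → ℝ} (hκ : Continuous κ)
    (b₀ b₁ b₂ b₃ : ℤ × ℤ → ℝ)
    (hm : ∀ k ∈ M.cells, k + (1, 0) ∈ M.cells →
      b₀ k + b₁ k * M.h₁ + b₂ k * M.h₁ ^ 2 + b₃ k * M.h₁ ^ 3 =
        b₀ (k + (1, 0)) + b₁ (k + (1, 0)) * -M.h₁ + b₂ (k + (1, 0)) * (-M.h₁) ^ 2 +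
          b₃ (k + (1, 0)) * (-M.h₁) ^ 3)
    (hR : ∀ k ∈ M.cells, k + (1, 0) ∉ M.cells →
      b₀ k + b₁ k * M.h₁ + b₂ k * M.h₁ ^ 2 + b₃ k * M.h₁ ^ 3 = 0)
    (hL : ∀ k ∈ M.cells, k - (1, 0) ∉ M.cells →
      b₀ k + b₁ k * -M.h₁ + b₂ k * (-M.h₁) ^ 2 + b₃ k * (-M.h₁) ^ 3 = 0) :
    M.IsNull fun k z =>
      (p z * (b₁ k + 2 * b₂ k * (z.1 - (M.center k).1) + 3 * b₃ k * (z.1 - (M.center k).1) ^ 2) +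
        q z * (b₀ k + b₁ k * (z.1 - (M.center k).1) + b₂ k * (z.1 - (M.center k).1) ^ 2 +
          b₃ k * (z.1 - (M.center k).1) ^ 3)) * κ (z.2 - (M.center k).2) := by
  have c1 : ∀ k, M.node₁ (k.1 + 1) - (M.center k).1 = M.h₁ := fun k => by
    simp only [center, node₁_add_one]; ring
  have c2 : ∀ k, M.node₁ k.1 - (M.center k).1 = -M.h₁ := fun k => by
    simp only [center]; ring
  constructor
  · intro k hk
    have hs := hT.openCell_subset hk
    refine ((integrableOn_openCell_mul hp hs (g := fun z => (b₁ k +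
      2 * b₂ k * (z.1 - (M.center k).1) + 3 * b₃ k * (z.1 - (M.center k).1) ^ 2) *
        κ (z.2 - (M.center k).2)) (by fun_prop)).add
      (integrableOn_openCell_mul hq hs (g := fun z => (b₀ k + b₁ k * (z.1 - (M.center k).1) +
        b₂ k * (z.1 - (M.center k).1) ^ 2 + b₃ k * (z.1 - (M.center k).1) ^ 3) *
        κ (z.2 - (M.center k).2)) (by fun_prop))).congr (Eventually.of_forall fun z => ?_)
    simp only [Pi.add_apply]
    ring
  · have key := hT.sum_setIntegral_fst_eq_zero hp hq h
      (ψ := fun k x => b₀ k + b₁ k * (x - (M.center k).1) + b₂ k * (x - (M.center k).1) ^ 2 +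
          b₃ k * (x - (M.center k).1) ^ 3) (χ := fun k y => κ (y - (M.center k).2))
      (fun k => by fun_prop) (fun k => by fun_prop) (fun k => by simp [center])
      (fun k hk hk' => by
        have := c2 (k + (1, 0))
        simp only [Prod.fst_add] at this
        simp only [c1, this]
        exact hm k hk hk')
      (fun k hk hk' => by simp only [c1]; exact hR k hk hk')
      (fun k hk hk' => by simp only [c2]; exact hL k hk hk')
    simpa only [(hasDerivAt_cubic _ _ _ _ _ _).deriv] using key

/-- Cubic polynomials in the second local coordinate whose values match across horizontal edges. -/
theorem Triangulates.isNull_snd (hT : M.Triangulates Ω) (hp : IntegrableOn p Ω)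
    (hq : IntegrableOn q Ω) (h : IsWeakDy Ω p q) {κ : ℝ → ℝ} (hκ : Continuous κ)
    (b₀ b₁ b₂ b₃ : ℤ × ℤ → ℝ)
    (hm : ∀ k ∈ M.cells, k + (0, 1) ∈ M.cells →
      b₀ k + b₁ k * M.h₂ + b₂ k * M.h₂ ^ 2 + b₃ k * M.h₂ ^ 3 =
        b₀ (k + (0, 1)) + b₁ (k + (0, 1)) * -M.h₂ + b₂ (k + (0, 1)) * (-M.h₂) ^ 2 +
          b₃ (k + (0, 1)) * (-M.h₂) ^ 3)
    (hR : ∀ k ∈ M.cells, k + (0, 1) ∉ M.cells →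
      b₀ k + b₁ k * M.h₂ + b₂ k * M.h₂ ^ 2 + b₃ k * M.h₂ ^ 3 = 0)
    (hL : ∀ k ∈ M.cells, k - (0, 1) ∉ M.cells →
      b₀ k + b₁ k * -M.h₂ + b₂ k * (-M.h₂) ^ 2 + b₃ k * (-M.h₂) ^ 3 = 0) :
    M.IsNull fun k z =>
      (p z * (b₁ k + 2 * b₂ k * (z.2 - (M.center k).2) + 3 * b₃ k * (z.2 - (M.center k).2) ^ 2) +
        q z * (b₀ k + b₁ k * (z.2 - (M.center k).2) + b₂ k * (z.2 - (M.center k).2) ^ 2 +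
          b₃ k * (z.2 - (M.center k).2) ^ 3)) * κ (z.1 - (M.center k).1) := by
  have c1 : ∀ k, M.node₂ (k.2 + 1) - (M.center k).2 = M.h₂ := fun k => by
    simp only [center, node₂_add_one]; ring
  have c2 : ∀ k, M.node₂ k.2 - (M.center k).2 = -M.h₂ := fun k => by
    simp only [center]; ring
  constructor
  · intro k hk
    have hs := hT.openCell_subset hk
    refine ((integrableOn_openCell_mul hp hs (g := fun z => (b₁ k +
      2 * b₂ k * (z.2 - (M.center k).2) + 3 * b₃ k * (z.2 - (M.center k).2) ^ 2) *
        κ (z.1 - (M.center k).1)) (by fun_prop)).add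
      (integrableOn_openCell_mul hq hs (g := fun z => (b₀ k + b₁ k * (z.2 - (M.center k).2) +
        b₂ k * (z.2 - (M.center k).2) ^ 2 + b₃ k * (z.2 - (M.center k).2) ^ 3) *
        κ (z.1 - (M.center k).1)) (by fun_prop))).congr (Eventually.of_forall fun z => ?_)
    simp only [Pi.add_apply]
    ring
  · have key := hT.sum_setIntegral_snd_eq_zero hp hq h
      (ψ := fun k x => b₀ k + b₁ k * (x - (M.center k).2) + b₂ k * (x - (M.center k).2) ^ 2 +
          b₃ k * (x - (M.center k).2) ^ 3) (χ := fun k y => κ (y - (M.center k).1))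
      (fun k => by fun_prop) (fun k => by fun_prop) (fun k => by simp [center])
      (fun k hk hk' => by
        have := c2 (k + (0, 1))
        simp only [Prod.snd_add] at this
        simp only [c1, this]
        exact hm k hk hk')
      (fun k hk hk' => by simp only [c1]; exact hR k hk hk')
      (fun k hk hk' => by simp only [c2]; exact hL k hk hk')
    simpa only [(hasDerivAt_cubic _ _ _ _ _ _).deriv] using key

/-- The integrand of `a_h(u, w) - (Δ²u, w)` on the cell with midpoint `c`, with `U α` the
derivatives of `u` and `a` the coefficients of `w`. -/
def errorIntegrand (U : ℕ × ℕ → ℝ × ℝ → ℝ) (c : ℝ × ℝ) (a : Fin 8 → ℝ) (z : ℝ × ℝ) : ℝ :=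
  U (2, 0) z * (2 * a 2 + 6 * a 3 * (z.1 - c.1)) + 2 * (U (1, 1) z * a 7) +
    U (0, 2) z * (2 * a 5 + 6 * a 6 * (z.2 - c.2)) -
    (U (4, 0) z + 2 * U (2, 2) z + U (0, 4) z) * localPoly c a z

variable (M) in
/-- What remains of `errorIntegrand` after element-wise integration by parts. -/
def remainder (U : ℕ × ℕ → ℝ × ℝ → ℝ) (c : ℝ × ℝ) (a : Fin 8 → ℝ) (z : ℝ × ℝ) : ℝ :=
  (U (4, 0) z * (a 5 + a 6 * (z.2 - c.2)) + U (3, 1) z * (a 7 / 2) +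
      2 * U (2, 2) z * (a 5 + a 6 * (z.2 - c.2))) * (M.h₂ ^ 2 - (z.2 - c.2) ^ 2) +
    (U (0, 4) z * (a 2 + a 3 * (z.1 - c.1)) + U (1, 3) z * (a 7 / 2) +
      2 * U (2, 2) z * (a 2 + a 3 * (z.1 - c.1))) * (M.h₁ ^ 2 - (z.1 - c.1) ^ 2)

theorem IsMatched.isNull_sub {a : ℤ × ℤ → Fin 8 → ℝ} (ha : M.IsMatched a)
    (hT : M.Triangulates Ω) {U : ℕ × ℕ → ℝ × ℝ → ℝ}
    (hU : ∀ α : ℕ × ℕ, α.1 + α.2 ≤ 4 → IntegrableOn (U α) Ω)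
    (hx : ∀ α : ℕ × ℕ, α.1 + α.2 ≤ 3 → IsWeakDx Ω (U α) (U (α + (1, 0))))
    (hy : ∀ α : ℕ × ℕ, α.1 + α.2 ≤ 3 → IsWeakDy Ω (U α) (U (α + (0, 1)))) :
    M.IsNull fun k z => errorIntegrand U (M.center k) (a k) z -
      M.remainder U (M.center k) (a k) z := by
  have h1 := M.h₁_pos
  have h2 := M.h₂_pos
  have n1 : 2 * M.h₁ ≠ 0 := by positivity
  have n2 : 2 * M.h₂ ≠ 0 := by positivity
  have one : Continuous (fun _ : ℝ => (1 : ℝ)) := continuous_const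
  have X := fun (α : ℕ × ℕ) (hα : α.1 + α.2 ≤ 3) (κ : ℝ → ℝ) (hκ : Continuous κ) =>
    hT.isNull_fst (hU α (by omega)) (hU (α + (1, 0)) (by simp; omega)) (hx α hα) hκ
  have Y := fun (α : ℕ × ℕ) (hα : α.1 + α.2 ≤ 3) (κ : ℝ → ℝ) (hκ : Continuous κ) =>
    hT.isNull_snd (hU α (by omega)) (hU (α + (0, 1)) (by simp; omega)) (hy α hα) hκ
  -- values of the first-variable reconstructions at vertical edges
  have gm : ∀ k ∈ M.cells, k + (1, 0) ∈ M.cells →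
      a k 4 + a k 6 * M.h₂ ^ 2 + a k 7 * M.h₁ + 0 * M.h₁ ^ 2 + 0 * M.h₁ ^ 3 =
        a (k + (1, 0)) 4 + a (k + (1, 0)) 6 * M.h₂ ^ 2 + a (k + (1, 0)) 7 * -M.h₁ +
          0 * (-M.h₁) ^ 2 + 0 * (-M.h₁) ^ 3 := fun k hk hk' => by
    have e1 := ha.val_fst k hk hk' _ (Or.inl rfl)
    have e2 := ha.val_fst k hk hk' _ (Or.inr rfl)
    simp only [morleyPoly] at e1 e2
    exact mul_left_cancel₀ n2 (by linarith)
  have gR : ∀ k ∈ M.cells, k + (1, 0) ∉ M.cells →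
      a k 4 + a k 6 * M.h₂ ^ 2 + a k 7 * M.h₁ + 0 * M.h₁ ^ 2 + 0 * M.h₁ ^ 3 = 0 :=
    fun k hk hk' => by
      have e1 := ha.val_right k hk hk' _ (Or.inl rfl)
      have e2 := ha.val_right k hk hk' _ (Or.inr rfl)
      simp only [morleyPoly] at e1 e2
      exact mul_left_cancel₀ n2 (by linarith)
  have gL : ∀ k ∈ M.cells, k - (1, 0) ∉ M.cells →
      a k 4 + a k 6 * M.h₂ ^ 2 + a k 7 * -M.h₁ + 0 * (-M.h₁) ^ 2 + 0 * (-M.h₁) ^ 3 = 0 :=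
    fun k hk hk' => by
      have e1 := ha.val_left k hk hk' _ (Or.inl rfl)
      have e2 := ha.val_left k hk hk' _ (Or.inr rfl)
      simp only [morleyPoly] at e1 e2
      exact mul_left_cancel₀ n2 (by linarith)
  -- values of the second-variable reconstructions at horizontal edges
  have em : ∀ k ∈ M.cells, k + (0, 1) ∈ M.cells →
      a k 1 + a k 3 * M.h₁ ^ 2 + a k 7 * M.h₂ + 0 * M.h₂ ^ 2 + 0 * M.h₂ ^ 3 =
        a (k + (0, 1)) 1 + a (k + (0, 1)) 3 * M.h₁ ^ 2 + a (k + (0, 1)) 7 * -M.h₂ +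
          0 * (-M.h₂) ^ 2 + 0 * (-M.h₂) ^ 3 := fun k hk hk' => by
    have e1 := ha.val_snd k hk hk' _ (Or.inl rfl)
    have e2 := ha.val_snd k hk hk' _ (Or.inr rfl)
    simp only [morleyPoly] at e1 e2
    exact mul_left_cancel₀ n1 (by linarith)
  have eR : ∀ k ∈ M.cells, k + (0, 1) ∉ M.cells →
      a k 1 + a k 3 * M.h₁ ^ 2 + a k 7 * M.h₂ + 0 * M.h₂ ^ 2 + 0 * M.h₂ ^ 3 = 0 :=
    fun k hk hk' => by
      have e1 := ha.val_top k hk hk' _ (Or.inl rfl)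
      have e2 := ha.val_top k hk hk' _ (Or.inr rfl)
      simp only [morleyPoly] at e1 e2
      exact mul_left_cancel₀ n1 (by linarith)
  have eL : ∀ k ∈ M.cells, k - (0, 1) ∉ M.cells →
      a k 1 + a k 3 * M.h₁ ^ 2 + a k 7 * -M.h₂ + 0 * (-M.h₂) ^ 2 + 0 * (-M.h₂) ^ 3 = 0 :=
    fun k hk hk' => by
      have e1 := ha.val_bottom k hk hk' _ (Or.inl rfl)
      have e2 := ha.val_bottom k hk hk' _ (Or.inr rfl)
      simp only [morleyPoly] at e1 e2
      exact mul_left_cancel₀ n1 (by linarith)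
  have D1 := X (2, 0) (by simp) _ one (fun k => a k 1) (fun k => 2 * a k 2) (fun k => 3 * a k 3)
    (fun _ => 0) (fun k hk hk' => by linarith [ha.slope_fst k hk hk'])
    (fun k hk hk' => by linarith [ha.slope_right k hk hk'])
    (fun k hk hk' => by linarith [ha.slope_left k hk hk'])
  have D2 := X (3, 0) (by simp) _ one (fun k => a k 0 + a k 5 * M.h₂ ^ 2) (fun k => a k 1)
    (fun k => a k 2) (fun k => a k 3)
    (fun k hk hk' => by
      have e1 := ha.val_fst k hk hk' _ (Or.inl rfl)
      have e2 := ha.val_fst k hk hk' _ (Or.inr rfl)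
      simp only [morleyPoly] at e1 e2
      linarith)
    (fun k hk hk' => by
      have e1 := ha.val_right k hk hk' _ (Or.inl rfl)
      have e2 := ha.val_right k hk hk' _ (Or.inr rfl)
      simp only [morleyPoly] at e1 e2
      linarith)
    (fun k hk hk' => by
      have e1 := ha.val_left k hk hk' _ (Or.inl rfl)
      have e2 := ha.val_left k hk hk' _ (Or.inr rfl)
      simp only [morleyPoly] at e1 e2
      linarith)
  have D3 := X (3, 0) (by simp) _ continuous_id (fun k => a k 4 + a k 6 * M.h₂ ^ 2)
    (fun k => a k 7) (fun _ => 0) (fun _ => 0) gm gR gL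
  have D4 := X (1, 1) (by simp) _ one (fun k => a k 4 + a k 6 * M.h₂ ^ 2)
    (fun k => a k 7) (fun _ => 0) (fun _ => 0) gm gR gL
  have Z2 := X (0, 3) (by simp) _ one (fun k => a k 7 * M.h₁ ^ 2) (fun _ => 0) (fun k => -a k 7)
    (fun _ => 0) (fun k _ _ => by ring) (fun k _ _ => by ring) (fun k _ _ => by ring)
  have E1 := Y (0, 2) (by simp) _ one (fun k => a k 4) (fun k => 2 * a k 5) (fun k => 3 * a k 6)
    (fun _ => 0) (fun k hk hk' => by linarith [ha.slope_snd k hk hk'])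
    (fun k hk hk' => by linarith [ha.slope_top k hk hk'])
    (fun k hk hk' => by linarith [ha.slope_bottom k hk hk'])
  have E2 := Y (0, 3) (by simp) _ one (fun k => a k 0 + a k 2 * M.h₁ ^ 2) (fun k => a k 4)
    (fun k => a k 5) (fun k => a k 6)
    (fun k hk hk' => by
      have e1 := ha.val_snd k hk hk' _ (Or.inl rfl)
      have e2 := ha.val_snd k hk hk' _ (Or.inr rfl)
      simp only [morleyPoly] at e1 e2
      linarith)
    (fun k hk hk' => by
      have e1 := ha.val_top k hk hk' _ (Or.inl rfl)
      have e2 := ha.val_top k hk hk' _ (Or.inr rfl)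
      simp only [morleyPoly] at e1 e2
      linarith)
    (fun k hk hk' => by
      have e1 := ha.val_bottom k hk hk' _ (Or.inl rfl)
      have e2 := ha.val_bottom k hk hk' _ (Or.inr rfl)
      simp only [morleyPoly] at e1 e2
      linarith)
  have E3 := Y (0, 3) (by simp) _ continuous_id (fun k => a k 1 + a k 3 * M.h₁ ^ 2)
    (fun k => a k 7) (fun _ => 0) (fun _ => 0) em eR eL
  have E5 := Y (2, 1) (by simp) _ one (fun k => a k 0 + a k 2 * M.h₁ ^ 2 + a k 5 * M.h₂ ^ 2)
    (fun k => a k 4 + a k 6 * M.h₂ ^ 2) (fun _ => 0) (fun _ => 0)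
    (fun k hk hk' => by
      have e1 := ha.val_snd k hk hk' _ (Or.inl rfl)
      have e2 := ha.val_snd k hk hk' _ (Or.inr rfl)
      simp only [morleyPoly] at e1 e2
      linarith)
    (fun k hk hk' => by
      have e1 := ha.val_top k hk hk' _ (Or.inl rfl)
      have e2 := ha.val_top k hk hk' _ (Or.inr rfl)
      simp only [morleyPoly] at e1 e2
      linarith)
    (fun k hk hk' => by
      have e1 := ha.val_bottom k hk hk' _ (Or.inl rfl)
      have e2 := ha.val_bottom k hk hk' _ (Or.inr rfl)
      simp only [morleyPoly] at e1 e2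
      linarith)
  have E6 := Y (2, 1) (by simp) _ continuous_id (fun k => a k 1 + a k 3 * M.h₁ ^ 2)
    (fun k => a k 7) (fun _ => 0) (fun _ => 0) em eR eL
  have Z1 := Y (3, 0) (by simp) _ one (fun k => a k 7 * M.h₂ ^ 2) (fun _ => 0) (fun k => -a k 7)
    (fun _ => 0) (fun k _ _ => by ring) (fun k _ _ => by ring) (fun k _ _ => by ring)
  have N := ((((((((((D1.add (D2.const_mul (-1))).add (D3.const_mul (-1))).add
    (Z1.const_mul (-1 / 2))).add (D4.const_mul 2)).add (E5.const_mul (-2))).add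
    (E6.const_mul (-2))).add E1).add (E2.const_mul (-1))).add (E3.const_mul (-1))).add
    (Z2.const_mul (-1 / 2)))
  refine N.congr fun k z => ?_
  simp only [Prod.mk_add_mk, Nat.reduceAdd, add_zero, zero_add, id, errorIntegrand, remainder,
    localPoly, morleyPoly]
  ring

end UniformMesh

theorem integral_mul_le_sqrt_mul_sqrt {X : Type*} [MeasurableSpace X] {μ : Measure X}
    {f g : X → ℝ} (hf : MemLp f 2 μ) (hg : MemLp g 2 μ) (hf0 : ∀ x, 0 ≤ f x)
    (hg0 : ∀ x, 0 ≤ g x) :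
    ∫ x, f x * g x ∂μ ≤ √(∫ x, f x ^ 2 ∂μ) * √(∫ x, g x ^ 2 ∂μ) := by
  have h := integral_mul_le_Lp_mul_Lq_of_nonneg (μ := μ) Real.HolderConjugate.two_two
    (Eventually.of_forall hf0) (Eventually.of_forall hg0) (by simpa using hf) (by simpa using hg)
  simpa [Real.sqrt_eq_rpow] using h

namespace UniformMesh

variable {M : UniformMesh} {Ω : Set (ℝ × ℝ)}

theorem Triangulates.measure_lt_top (hT : M.Triangulates Ω) : volume Ω < ⊤ :=
  (measure_mono hT.subset_iUnion).trans_lt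
    (measure_biUnion_lt_top M.cells.finite_toSet fun _ _ => isCompact_Icc.measure_lt_top)

theorem Triangulates.integrableOn (hT : M.Triangulates Ω) {v : ℝ × ℝ → ℝ} (hv : MemL2 Ω v) :
    IntegrableOn v Ω := by
  have : IsFiniteMeasure (volume.restrict Ω) := ⟨by simpa using hT.measure_lt_top⟩
  exact MemLp.integrable (by norm_num) hv

theorem memLp_openCell (k : ℤ × ℤ) {g : ℝ × ℝ → ℝ} (hg : Continuous g) :
    MemLp g 2 (volume.restrict (M.openCell k)) := by
  have h1 : IntegrableOn (fun z => g z ^ 2) (M.openCell k) :=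
    ((hg.pow 2).continuousOn.integrableOn_compact (K := M.cell k) isCompact_Icc).mono_set
      (M.openCell_subset_cell k)
  exact (memLp_two_iff_integrable_sq hg.aestronglyMeasurable).2 h1

theorem integrableOn_openCell (k : ℤ × ℤ) {g : ℝ × ℝ → ℝ} (hg : Continuous g) :
    IntegrableOn g (M.openCell k) :=
  (hg.continuousOn.integrableOn_compact (K := M.cell k) isCompact_Icc).mono_set
    (M.openCell_subset_cell k)

theorem setIntegral_openCell_fst_sub_center (k : ℤ × ℤ) :
    ∫ z in M.openCell k, (z.1 - (M.center k).1) = 0 := by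
  have h := setIntegral_prod_mul (μ := volume) (ν := volume) (fun x => x - (M.center k).1)
    (fun _ => (1 : ℝ)) (Set.Ioo (M.node₁ k.1) (M.node₁ (k.1 + 1)))
    (Set.Ioo (M.node₂ k.2) (M.node₂ (k.2 + 1)))
  have e := integral_affine_symm 0 1 (M.center k).1 M.h₁
  have e1 : (M.center k).1 - M.h₁ = M.node₁ k.1 := by simp [center]
  have e2 : (M.center k).1 + M.h₁ = M.node₁ (k.1 + 1) := by
    simp only [center, node₁_add_one]; ring
  rw [e1, e2, ← setIntegral_Ioo_eq_intervalIntegral (M.node₁_lt _).le] at e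
  simp only [zero_add, one_mul, mul_zero] at e
  rw [e, zero_mul] at h
  simpa [Measure.volume_eq_prod, openCell] using h

theorem setIntegral_openCell_snd_sub_center (k : ℤ × ℤ) :
    ∫ z in M.openCell k, (z.2 - (M.center k).2) = 0 := by
  have h := setIntegral_prod_mul (μ := volume) (ν := volume) (fun _ => (1 : ℝ))
    (fun x => x - (M.center k).2) (Set.Ioo (M.node₁ k.1) (M.node₁ (k.1 + 1)))
    (Set.Ioo (M.node₂ k.2) (M.node₂ (k.2 + 1)))
  have e := integral_affine_symm 0 1 (M.center k).2 M.h₂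
  have e1 : (M.center k).2 - M.h₂ = M.node₂ k.2 := by simp [center]
  have e2 : (M.center k).2 + M.h₂ = M.node₂ (k.2 + 1) := by
    simp only [center, node₂_add_one]; ring
  rw [e1, e2, ← setIntegral_Ioo_eq_intervalIntegral (M.node₂_lt _).le] at e
  simp only [zero_add, one_mul, mul_zero] at e
  rw [e, mul_zero] at h
  simpa [Measure.volume_eq_prod, openCell] using h

/-- The squared energy density of a shape function. -/
def energyDensity (c : ℝ × ℝ) (a : Fin 8 → ℝ) (z : ℝ × ℝ) : ℝ :=
  (2 * a 2 + 6 * a 3 * (z.1 - c.1)) ^ 2 + 2 * a 7 ^ 2 + (2 * a 5 + 6 * a 6 * (z.2 - c.2)) ^ 2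

/-- A combination of the Taylor coefficients of a shape function that is controlled by its
energy. -/
def coeffSize (c : ℝ × ℝ) (a : Fin 8 → ℝ) (z : ℝ × ℝ) : ℝ :=
  |a 2 + a 3 * (z.1 - c.1)| + |a 5 + a 6 * (z.2 - c.2)| + |a 7|

theorem setIntegral_coeffSize_sq_le (k : ℤ × ℤ) (a : Fin 8 → ℝ) :
    ∫ z in M.openCell k, coeffSize (M.center k) a z ^ 2 ≤
      3 * ∫ z in M.openCell k, energyDensity (M.center k) a z := by
  set c := M.center k with hc
  have c1 : Continuous (fun z : ℝ × ℝ => 22 * (a 2 * a 3) * (z.1 - c.1)) := by fun_prop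
  have c2 : Continuous (fun z : ℝ × ℝ => 22 * (a 5 * a 6) * (z.2 - c.2)) := by fun_prop
  have c3 : Continuous (energyDensity c a) := by unfold energyDensity; fun_prop
  have e : ∫ z in M.openCell k, (energyDensity c a z - (22 * (a 2 * a 3) * (z.1 - c.1) +
      22 * (a 5 * a 6) * (z.2 - c.2))) = ∫ z in M.openCell k, energyDensity c a z := by
    have c4 : Continuous (fun z : ℝ × ℝ => 22 * (a 2 * a 3) * (z.1 - c.1) +
        22 * (a 5 * a 6) * (z.2 - c.2)) := c1.add c2
    rw [integral_sub (integrableOn_openCell k c3) (integrableOn_openCell k c4),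
      integral_add (integrableOn_openCell k c1) (integrableOn_openCell k c2),
      integral_const_mul, integral_const_mul, setIntegral_openCell_fst_sub_center,
      setIntegral_openCell_snd_sub_center]
    ring
  rw [← e, ← integral_const_mul]
  refine integral_mono (integrableOn_openCell k (by unfold coeffSize; fun_prop))
    (integrableOn_openCell k ((c3.sub (c1.add c2)).const_mul 3 |>.congr fun z => rfl)) fun z => ?_
  simp only [coeffSize, energyDensity]
  set s := |a 2 + a 3 * (z.1 - c.1)| with hs
  set t := |a 5 + a 6 * (z.2 - c.2)| with ht
  have hs2 : s ^ 2 = (a 2 + a 3 * (z.1 - c.1)) ^ 2 := sq_abs _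
  have ht2 : t ^ 2 = (a 5 + a 6 * (z.2 - c.2)) ^ 2 := sq_abs _
  have hr2 : |a 7| ^ 2 = a 7 ^ 2 := sq_abs _
  have h3 : (s + t + |a 7|) ^ 2 ≤ 3 * (s ^ 2 + t ^ 2 + |a 7| ^ 2) := by
    nlinarith [sq_nonneg (s - t), sq_nonneg (s - |a 7|), sq_nonneg (t - |a 7|)]
  rw [hs2, ht2, hr2] at h3
  nlinarith [sq_nonneg (a 2), sq_nonneg (a 3 * (z.1 - c.1)), sq_nonneg (a 5),
    sq_nonneg (a 6 * (z.2 - c.2)), sq_nonneg (a 7)]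

/-- The size of the fourth derivatives that enter the remainder. -/
def derivSize (U : ℕ × ℕ → ℝ × ℝ → ℝ) (z : ℝ × ℝ) : ℝ :=
  |U (4, 0) z| + |U (3, 1) z| + 2 * |U (2, 2) z| + |U (1, 3) z| + |U (0, 4) z|

theorem derivSize_sq_le (U : ℕ × ℕ → ℝ × ℝ → ℝ) (z : ℝ × ℝ) :
    derivSize U z ^ 2 ≤ 8 * (U (4, 0) z ^ 2 + U (3, 1) z ^ 2 + U (2, 2) z ^ 2 + U (1, 3) z ^ 2 +
      U (0, 4) z ^ 2) := by
  rw [← sq_abs (U (4, 0) z), ← sq_abs (U (3, 1) z), ← sq_abs (U (2, 2) z), ← sq_abs (U (1, 3) z),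
    ← sq_abs (U (0, 4) z), derivSize]
  generalize |U (4, 0) z| = p
  generalize |U (3, 1) z| = q
  generalize |U (2, 2) z| = r
  generalize |U (1, 3) z| = s
  generalize |U (0, 4) z| = t
  nlinarith [sq_nonneg (p - q), sq_nonneg (p - s), sq_nonneg (p - t), sq_nonneg (q - s),
    sq_nonneg (q - t), sq_nonneg (s - t), sq_nonneg (r - 2 * p), sq_nonneg (r - 2 * q),
    sq_nonneg (r - 2 * s), sq_nonneg (r - 2 * t)]

theorem remainder_le (U : ℕ × ℕ → ℝ × ℝ → ℝ) (k : ℤ × ℤ) (a : Fin 8 → ℝ) {z : ℝ × ℝ}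
    (hz : z ∈ M.openCell k) :
    M.remainder U (M.center k) a z ≤ M.h ^ 2 * (derivSize U z * coeffSize (M.center k) a z) := by
  obtain ⟨⟨x1, x2⟩, y1, y2⟩ := hz
  rw [node₁_add_one] at x2
  rw [node₂_add_one] at y2
  have h1 := M.h₁_pos
  have h2 := M.h₂_pos
  set X := z.1 - (M.center k).1 with hX
  set Y := z.2 - (M.center k).2 with hY
  have X1 : -M.h₁ < X := by simp only [hX, center]; linarith
  have X2 : X < M.h₁ := by simp only [hX, center]; linarith
  have Y1 : -M.h₂ < Y := by simp only [hY, center]; linarith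
  have Y2 : Y < M.h₂ := by simp only [hY, center]; linarith
  have bX0 : 0 ≤ M.h₁ ^ 2 - X ^ 2 := by nlinarith
  have bY0 : 0 ≤ M.h₂ ^ 2 - Y ^ 2 := by nlinarith
  have bX : M.h₁ ^ 2 - X ^ 2 ≤ M.h ^ 2 := by
    have : M.h₁ ^ 2 ≤ M.h ^ 2 := pow_le_pow_left₀ h1.le (le_max_left _ _) 2
    nlinarith [sq_nonneg X]
  have bY : M.h₂ ^ 2 - Y ^ 2 ≤ M.h ^ 2 := by
    have : M.h₂ ^ 2 ≤ M.h ^ 2 := pow_le_pow_left₀ h2.le (le_max_right _ _) 2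
    nlinarith [sq_nonneg Y]
  have key : ∀ t b : ℝ, 0 ≤ b → b ≤ M.h ^ 2 → t * b ≤ M.h ^ 2 * |t| := fun t b hb hb' => by
    calc t * b ≤ |t| * b := mul_le_mul_of_nonneg_right (le_abs_self t) hb
      _ ≤ |t| * M.h ^ 2 := mul_le_mul_of_nonneg_left hb' (abs_nonneg t)
      _ = M.h ^ 2 * |t| := mul_comm _ _
  have tri : ∀ p q r s t : ℝ, |p * s + q * (t / 2) + 2 * r * s| ≤
      |p| * |s| + |q| * |t| + 2 * |r| * |s| := fun p q r s t => by
    refine (abs_add_three _ _ _).trans ?_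
    rw [abs_mul, abs_mul, abs_mul, abs_mul, abs_div, abs_two]
    have := mul_nonneg (abs_nonneg q) (abs_nonneg t)
    linarith
  unfold remainder derivSize coeffSize
  rw [← hX, ← hY]
  refine (add_le_add (key _ _ bY0 bY) (key _ _ bX0 bX)).trans ?_
  rw [← mul_add]
  refine mul_le_mul_of_nonneg_left ?_ (sq_nonneg _)
  refine (add_le_add (tri _ _ _ _ _) (tri _ _ _ _ _)).trans ?_
  have n := fun (p q : ℝ) => mul_nonneg (abs_nonneg p) (abs_nonneg q)
  set s := a 2 + a 3 * X
  set t := a 5 + a 6 * Y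
  linarith [n (U (4, 0) z) s, n (U (4, 0) z) (a 7), n (U (3, 1) z) s, n (U (3, 1) z) t,
    n (U (2, 2) z) (a 7), n (U (1, 3) z) s, n (U (1, 3) z) t, n (U (0, 4) z) t,
    n (U (0, 4) z) (a 7)]

theorem sum_setIntegral_remainder_le (hT : M.Triangulates Ω) {U : ℕ × ℕ → ℝ × ℝ → ℝ}
    (hU : ∀ α : ℕ × ℕ, α.1 + α.2 ≤ 4 → MemL2 Ω (U α)) (a : ℤ × ℤ → Fin 8 → ℝ)
    (hR : ∀ k ∈ M.cells, IntegrableOn (M.remainder U (M.center k) (a k)) (M.openCell k)) :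
    ∑ k ∈ M.cells, ∫ z in M.openCell k, M.remainder U (M.center k) (a k) z ≤
      5 * M.h ^ 2 * √(∑ α ∈ Finset.HasAntidiagonal.antidiagonal 4, ∫ z in Ω, U α z ^ 2) *
        √(∑ k ∈ M.cells, ∫ z in M.openCell k, energyDensity (M.center k) (a k) z) := by
  have hG : MemL2 Ω (derivSize U) := by
    have h := fun α hα => (hU α hα).norm
    exact ((((h (4, 0) (by simp)).add (h (3, 1) (by simp))).add
      ((h (2, 2) (by simp)).const_mul 2)).add (h (1, 3) (by simp))).add (h (0, 4) (by simp))
  have hG0 : ∀ z, 0 ≤ derivSize U z := fun z => by unfold derivSize; positivity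
  have hW0 : ∀ c a z, 0 ≤ coeffSize c a z := fun c a z => by unfold coeffSize; positivity
  have hWc : ∀ c a, Continuous (coeffSize c a) := fun c a => by unfold coeffSize; fun_prop
  have hGk : ∀ k ∈ M.cells, MemLp (derivSize U) 2 (volume.restrict (M.openCell k)) :=
    fun k hk => hG.mono_measure (Measure.restrict_mono (hT.openCell_subset hk) le_rfl)
  have step1 : ∀ k ∈ M.cells, ∫ z in M.openCell k, M.remainder U (M.center k) (a k) z ≤
      M.h ^ 2 * (√(∫ z in M.openCell k, derivSize U z ^ 2) *
        √(∫ z in M.openCell k, coeffSize (M.center k) (a k) z ^ 2)) := by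
    intro k hk
    refine le_trans ?_ (mul_le_mul_of_nonneg_left (integral_mul_le_sqrt_mul_sqrt (hGk k hk)
      (memLp_openCell k (hWc (M.center k) (a k))) hG0 (hW0 _ _)) (sq_nonneg _))
    rw [← integral_const_mul]
    refine setIntegral_mono_on (hR k hk)
      ((MemLp.integrable_mul (hGk k hk) (memLp_openCell k (hWc _ _))).const_mul _)
      (M.isOpen_openCell k).measurableSet fun z hz => remainder_le U k (a k) hz
  have step2 : ∑ k ∈ M.cells, ∫ z in M.openCell k, derivSize U z ^ 2 ≤
      8 * ∑ α ∈ Finset.HasAntidiagonal.antidiagonal 4, ∫ z in Ω, U α z ^ 2 := by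
    rw [← hT.setIntegral_eq_sum hG.integrable_sq]
    have i : ∀ α : ℕ × ℕ, α.1 + α.2 = 4 → IntegrableOn (fun z => U α z ^ 2) Ω :=
      fun α hα => (hU α hα.le).integrable_sq
    rw [← integral_finsetSum _ fun α hα => i α (Finset.HasAntidiagonal.mem_antidiagonal.1 hα),
      ← integral_const_mul]
    refine integral_mono hG.integrable_sq ((integrable_finsetSum _ fun α hα =>
      i α (Finset.HasAntidiagonal.mem_antidiagonal.1 hα)).const_mul 8) fun z => ?_
    have e : ∑ α ∈ Finset.HasAntidiagonal.antidiagonal 4, U α z ^ 2 = U (4, 0) z ^ 2 +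
        U (3, 1) z ^ 2 + U (2, 2) z ^ 2 + U (1, 3) z ^ 2 + U (0, 4) z ^ 2 := by
      simp [Finset.Nat.antidiagonal_succ]
      ring
    simp only [e]
    exact derivSize_sq_le U z
  have step3 : ∑ k ∈ M.cells, ∫ z in M.openCell k, coeffSize (M.center k) (a k) z ^ 2 ≤
      3 * ∑ k ∈ M.cells, ∫ z in M.openCell k, energyDensity (M.center k) (a k) z := by
    rw [Finset.mul_sum]
    exact Finset.sum_le_sum fun k _ => setIntegral_coeffSize_sq_le k (a k)
  refine (Finset.sum_le_sum step1).trans ?_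
  rw [← Finset.mul_sum]
  have cs := Real.sum_sqrt_mul_sqrt_le M.cells
    (f := fun k => ∫ z in M.openCell k, derivSize U z ^ 2)
    (g := fun k => ∫ z in M.openCell k, coeffSize (M.center k) (a k) z ^ 2)
    (fun k => integral_nonneg fun z => sq_nonneg _) (fun k => integral_nonneg fun z => sq_nonneg _)
  have h24 : √8 * √3 ≤ (5 : ℝ) := by
    rw [← Real.sqrt_mul (by norm_num), Real.sqrt_le_left (by norm_num)]
    norm_num
  set S := ∑ α ∈ Finset.HasAntidiagonal.antidiagonal 4, ∫ z in Ω, U α z ^ 2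
  set Q := ∑ k ∈ M.cells, ∫ z in M.openCell k, energyDensity (M.center k) (a k) z
  calc _ ≤ M.h ^ 2 * (√(8 * S) * √(3 * Q)) :=
        mul_le_mul_of_nonneg_left (cs.trans (mul_le_mul (Real.sqrt_le_sqrt step2)
          (Real.sqrt_le_sqrt step3) (Real.sqrt_nonneg _) (Real.sqrt_nonneg _))) (sq_nonneg _)
    _ = (√8 * √3) * (M.h ^ 2 * (√S * √Q)) := by
        rw [Real.sqrt_mul (by norm_num), Real.sqrt_mul (by norm_num)]
        ring
    _ ≤ 5 * (M.h ^ 2 * (√S * √Q)) := mul_le_mul_of_nonneg_right h24 (by positivity)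
    _ = _ := by ring

end UniformMesh

namespace UniformMesh

variable {M : UniformMesh} {Ω : Set (ℝ × ℝ)}

/-- The second derivatives of a Morley function on a cell are those of its local polynomial. -/
theorem isWeakDeriv_openCell (hT : M.Triangulates Ω) {w : ℝ × ℝ → ℝ} (hw : MemL2 Ω w)
    {k : ℤ × ℤ} (hk : k ∈ M.cells) {a : Fin 8 → ℝ}
    (he : w =ᵐ[volume.restrict (M.cell k)] localPoly (M.center k) a) (α : ℕ × ℕ) :
    IsWeakDeriv (M.openCell k) α w (partialDeriv α (localPoly (M.center k) a)) :=
  (IsWeakDeriv.of_contDiff _ α (contDiff_localPoly _ _)).congr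
    (ae_restrict_of_ae_restrict_of_subset (M.openCell_subset_cell k) he)
    ((hT.integrableOn hw).mono_set (hT.openCell_subset hk)).locallyIntegrableOn

theorem discreteForm_self (hT : M.Triangulates Ω) {w : ℝ × ℝ → ℝ} (hw : MemL2 Ω w)
    {a : ℤ × ℤ → Fin 8 → ℝ}
    (he : ∀ k ∈ M.cells, w =ᵐ[volume.restrict (M.cell k)] localPoly (M.center k) (a k)) :
    M.discreteForm w w =
      ∑ k ∈ M.cells, ∫ z in M.openCell k, energyDensity (M.center k) (a k) z := by
  refine Finset.sum_congr rfl fun k hk => ?_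
  have hW := isWeakDeriv_openCell hT hw hk (he k hk)
  rw [interior_cell, hessForm_congr (M.isOpen_openCell k) (fun α _ => hW α) (fun α _ => hW α)]
  simp only [partialDeriv_localPoly_xx, partialDeriv_localPoly_xy, partialDeriv_localPoly_yy]
  congr 1
  funext z
  simp only [energyDensity]
  ring

theorem discreteForm_sub_eq (hT : M.Triangulates Ω) {f u w : ℝ × ℝ → ℝ} (hf : MemL2 Ω f)
    (hu : MemH Ω 4 u) (hfu : IsBiharmonicSolution Ω f u) (hw : MemL2 Ω w)
    {a : ℤ × ℤ → Fin 8 → ℝ}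
    (he : ∀ k ∈ M.cells, w =ᵐ[volume.restrict (M.cell k)] localPoly (M.center k) (a k)) :
    (∀ k ∈ M.cells, IntegrableOn
      (errorIntegrand (fun α => weakDeriv Ω α u) (M.center k) (a k)) (M.openCell k)) ∧
    M.discreteForm u w - ∫ z in Ω, f z * w z = ∑ k ∈ M.cells, ∫ z in M.openCell k,
      errorIntegrand (fun α => weakDeriv Ω α u) (M.center k) (a k) z := by
  have hΩ := hT.isOpen
  have L : ∀ α : ℕ × ℕ, α.1 + α.2 ≤ 4 → IntegrableOn (weakDeriv Ω α u) Ω := fun α hα =>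
    hT.integrableOn (hu.memL2_weakDeriv hΩ hα)
  have iH : ∀ k ∈ M.cells, IntegrableOn (fun z =>
      weakDeriv Ω (2, 0) u z * (2 * a k 2 + 6 * a k 3 * (z.1 - (M.center k).1)) +
      2 * (weakDeriv Ω (1, 1) u z * a k 7) +
      weakDeriv Ω (0, 2) u z * (2 * a k 5 + 6 * a k 6 * (z.2 - (M.center k).2)))
      (M.openCell k) := fun k hk => by
    have hs := hT.openCell_subset hk
    exact ((integrableOn_openCell_mul (L (2, 0) (by simp)) hs
      (g := fun z => 2 * a k 2 + 6 * a k 3 * (z.1 - (M.center k).1)) (by fun_prop)).add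
      ((integrableOn_openCell_mul (L (1, 1) (by simp)) hs
        (g := fun _ => a k 7) (by fun_prop)).const_mul 2)).add
      (integrableOn_openCell_mul (L (0, 2) (by simp)) hs
      (g := fun z => 2 * a k 5 + 6 * a k 6 * (z.2 - (M.center k).2)) (by fun_prop))
  have iF : ∀ k ∈ M.cells, IntegrableOn (fun z => (weakDeriv Ω (4, 0) u z +
      2 * weakDeriv Ω (2, 2) u z + weakDeriv Ω (0, 4) u z) * localPoly (M.center k) (a k) z)
      (M.openCell k) := fun k hk =>
    integrableOn_openCell_mul (((L (4, 0) (by simp)).add ((L (2, 2) (by simp)).const_mul 2)).add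
      (L (0, 4) (by simp))) (hT.openCell_subset hk) (contDiff_localPoly _ _).continuous
  refine ⟨fun k hk => (iH k hk).sub (iF k hk), ?_⟩
  rw [hT.setIntegral_eq_sum (F := fun z => f z * w z) (MemLp.integrable_mul hf hw), discreteForm,
    ← Finset.sum_sub_distrib]
  refine Finset.sum_congr rfl fun k hk => ?_
  have hs := hT.openCell_subset hk
  have hW := isWeakDeriv_openCell hT hw hk (he k hk)
  have e1 : ∫ z in M.openCell k, f z * w z = ∫ z in M.openCell k, (weakDeriv Ω (4, 0) u z +
      2 * weakDeriv Ω (2, 2) u z + weakDeriv Ω (0, 4) u z) *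
        localPoly (M.center k) (a k) z := by
    refine integral_congr_ae ?_
    filter_upwards [ae_restrict_of_ae_restrict_of_subset (M.openCell_subset_cell k) (he k hk),
      ae_restrict_of_ae_restrict_of_subset hs
        (hfu.ae_eq hΩ (hT.integrableOn hf).locallyIntegrableOn hf hu)] with z h1 h2
    rw [h1, h2]
  rw [interior_cell, hessForm_congr (M.isOpen_openCell k)
    (fun α hα => (hu.isWeakDeriv (α := α) (by omega)).mono hs) (fun α _ => hW α), e1]
  simp only [partialDeriv_localPoly_xx, partialDeriv_localPoly_xy, partialDeriv_localPoly_yy]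
  rw [← integral_sub (iH k hk) (iF k hk)]
  rfl

/-- The consistency error estimate for the rectangular Morley element. -/
theorem consistency_error_le (hT : M.Triangulates Ω) {f u w : ℝ × ℝ → ℝ} (hf : MemL2 Ω f)
    (hu : MemH Ω 4 u) (hfu : IsBiharmonicSolution Ω f u) (hw : M.MemMorley Ω w) :
    M.discreteForm u w - ∫ z in Ω, f z * w z ≤
      5 * M.h ^ 2 * seminormH Ω 4 u * M.discreteSeminorm w := by
  obtain ⟨hw2, p, hp, hwp⟩ := hw
  choose! a ha using fun k (hk : k ∈ M.cells) => exists_eq_localPoly (M.center k) (hp.shape k hk)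
  have he : ∀ k ∈ M.cells, w =ᵐ[volume.restrict (M.cell k)] localPoly (M.center k) (a k) :=
    fun k hk => ha k hk ▸ hwp k hk
  have hL : ∀ α : ℕ × ℕ, α.1 + α.2 ≤ 4 → MemL2 Ω (weakDeriv Ω α u) := fun α hα =>
    hu.memL2_weakDeriv hT.isOpen hα
  obtain ⟨hi, e⟩ := discreteForm_sub_eq hT hf hu hfu hw2 he
  have N := (hp.isMatched hT ha).isNull_sub hT (U := fun α => weakDeriv Ω α u)
    (fun α hα => hT.integrableOn (hL α hα))
    (fun α hα => (hu.isWeakDeriv (by omega)).isWeakDx (hu.isWeakDeriv (by simp; omega)))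
    (fun α hα => (hu.isWeakDeriv (by omega)).isWeakDy (hu.isWeakDeriv (by simp; omega)))
  have hR : ∀ k ∈ M.cells, IntegrableOn
      (M.remainder (fun α => weakDeriv Ω α u) (M.center k) (a k)) (M.openCell k) := fun k hk =>
    ((hi k hk).sub (N.integrableOn k hk)).congr (Eventually.of_forall fun z => by simp)
  have e2 := N.sum_eq_zero
  rw [Finset.sum_congr rfl fun k hk => integral_sub (hi k hk) (hR k hk), Finset.sum_sub_distrib,
    sub_eq_zero] at e2
  rw [e, e2, discreteSeminorm, discreteForm_self hT hw2 he]
  exact sum_setIntegral_remainder_le hT hL a hR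

end UniformMesh

end RectMorley

end

theorem mainTheorem5 (σ : ℝ) :
    ∃ C : ℝ, 0 < C ∧
      ∀ (Ω : Set (ℝ × ℝ)) (M : UniformMesh), M.Triangulates Ω →
        M.h₁ ≤ σ * M.h₂ → M.h₂ ≤ σ * M.h₁ →
        ∀ f u : ℝ × ℝ → ℝ, MemL2 Ω f → MemH Ω 4 u → IsBiharmonicSolution Ω f u →
          ∀ w : ℝ × ℝ → ℝ, M.MemMorley Ω w →
            M.discreteForm u w - ∫ z in Ω, f z * w z
              ≤ C * M.h ^ 2 * (normL2 Ω f + seminormH Ω 4 u) * M.discreteSeminorm w := by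
  refine ⟨5, by norm_num, fun Ω M hT _ _ f u hf hu hfu w hw => ?_⟩
  refine (UniformMesh.consistency_error_le hT hf hu hfu hw).trans ?_
  have h0 : 0 ≤ normL2 Ω f := Real.sqrt_nonneg _
  refine mul_le_mul_of_nonneg_right (mul_le_mul_of_nonneg_left (by linarith) (by positivity))
    (Real.sqrt_nonneg _)
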